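/- **Model.** There are $T$ periods, $I$ demand types and $J$ supply types. The rewards are $r_{ijts}\ge 0$ and the arrival probabilities are $\lambda_{it}>0$, $\mu_{js}>0$, with $\sum_i\lambda_{it}\le 1$ and $\sum_j\mu_{js}\le 1$ for all periods $t,s$. Let $u_1,\dots,u_T,v_1,\dots,v_T,w_1,\dots,w_T$ be mutually independent random variables, uniform on $[0,1]$. Demand unit $(i,t)$ arrives iff $\Lambda_{it}=1$ and supply unit $(j,s)$ arrives iff $M_{js}=1$, where $$\Lambda_{it}=\mathbf 1\Big\{u_t\in\Big[\sum_{k<i}\lambda_{kt},\sum_{k\le i}\lambda_{kt}\Big)\Big\},\qquad M_{js}=\mathbf 1\Big\{v_s\in\Big[\sum_{k<j}\mu_{ks},\sum_{k\le j}\mu_{ks}\Big)\Big\}.$$ Let $S_t=(M_{js'})_{j,\,s'\le t}$. **Linear programs.** For $a=(a_{it})$ and $b=(b_{js})$, let $\mathrm{LP}(a,b)$ be the problem of maximizing $\sum_{i,j,t,s}x_{ijts}r_{ijts}$ subject to $\sum_{i,t}x_{ijts}\le b_{js}$, $\sum_{j,s}x_{ijts}\le a_{it}$, $0\le x_{ijts}\le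 a_{it}b_{js}$, and $x_{ijts}=0$ for $s>t$. The maximum offline reward $V^{OFF}(\Lambda,M)$ is the optimal value of $\mathrm{LP}(\Lambda,M)$. **Online algorithm.** Let $x^*$ be any optimal solution of $\mathrm{LP}(\lambda,\mu)$, and put $$p_{ijts}(S_t)=\frac{\min\big(\lambda_{it},\,Q_{it}\big)}{Q_{it}}\,M_{js}\frac{x^*_{ijts}}{\mu_{js}},\qquad Q_{it}=\sum_{j'=1}^J\sum_{s'=1}^{t}M_{j's'}\frac{x^*_{ij't s'}}{\mu_{j's'}}$$ (read as $0$ if $Q_{it}=0$), and $$h_{js}(S_t)=\mathbb E\left[\frac{\sum_{t'=t+1}^T\sum_{i}r_{ijt's}\,p_{ijt's}(S_{t'})}{2-\sum_{t'=1}^t\sum_i p_{ijt's}(S_{t'})}\,\Big|\,S_t\right].$$ When demand unit $(i,t)$ arrives, the algorithm uses $w_t$ to pick at most one supply unit, the unit $(j,s)$ being picked with probability $p_{ijts}(S_t)/\lambda_{it}$: the pairs $(j,s)$ are ordered lexicographically, and $(j,s)$ is picked iff $w_t$ lies in the half-open interval from the sum of the probabilities of the pairs before $(j,s)$ to the sum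 of those up to and including $(j,s)$. If $(j,s)$ is picked, has not yet been matched, and $r_{ijts}\ge h_{js}(S_t)$, then $(i,t)$ is matched to $(j,s)$ and the reward $r_{ijts}$ is earned; otherwise $(i,t)$ is rejected. Let $V^{ON}$ be the total reward earned. **Theorem.** $V^{ON}$ and $V^{OFF}(\Lambda,M)$ are integrable, and $$\mathbb E[V^{ON}]\ \ge\ \tfrac14\,\mathbb E\big[V^{OFF}(\Lambda,M)\big].$$ -/

import Mathlib

open MeasureTheory ProbabilityTheory

noncomputable section

/-- The indicator `1{u ∈ [∑_{b < a} q b, ∑_{b ≤ a} q b)}`. If `q ≥ 0`, `∑ q ≤ 1` and `u` is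
uniform on `[0,1]`, this samples at most one element of `α`, element `a` with probability `q a`. -/
def drawIndicator {α : Type*} [Fintype α] [LinearOrder α] (q : α → ℝ) (a : α) (u : ℝ) : ℝ :=
  (Set.Ico (∑ b with b < a, q b) (∑ b with b ≤ a, q b)).indicator 1 u

/-- Constraints of the assignment linear program with demand capacities `a i t` and supply
capacities `b j s`; `x i j t s` is the amount of demand `(i,t)` assigned to supply `(j,s)`.
With `a = λ`, `b = μ` it is the deterministic program; with `a = Λ`, `b = M` (the realized
arrivals) it is the offline matching program. -/
structure AssignmentFeasible {I J T : ℕ} (a : Fin I → Fin T → ℝ) (b : Fin J → Fin T → ℝ)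
    (x : Fin I → Fin J → Fin T → Fin T → ℝ) : Prop where
  supply : ∀ j s, ∑ i, ∑ t, x i j t s ≤ b j s
  demand : ∀ i t, ∑ j, ∑ s, x i j t s ≤ a i t
  pair : ∀ i j t s, x i j t s ≤ a i t * b j s
  causal : ∀ i j t s, t < s → x i j t s = 0
  nonneg : ∀ i j t s, 0 ≤ x i j t s

/-- The data of a two-sided matching market with `I` demand types, `J` supply types and `T`
periods: the rewards `r i j t s` and the arrival probabilities `lam i t`, `mu j s`. -/
structure Market (I J T : ℕ) where
  r : Fin I → Fin J → Fin T → Fin T → ℝ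
  lam : Fin I → Fin T → ℝ
  mu : Fin J → Fin T → ℝ
  r_nonneg : ∀ i j t s, 0 ≤ r i j t s
  lam_pos : ∀ i t, 0 < lam i t
  mu_pos : ∀ j s, 0 < mu j s
  sum_lam_le_one : ∀ t, ∑ i, lam i t ≤ 1
  sum_mu_le_one : ∀ s, ∑ j, mu j s ≤ 1

namespace Market

variable {I J T : ℕ} (K : Market I J T)

/-- Total reward of an assignment. -/
def objective (x : Fin I → Fin J → Fin T → Fin T → ℝ) : ℝ :=
  ∑ i, ∑ j, ∑ t, ∑ s, x i j t s * K.r i j t s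

/-- `x` is an optimal solution of the deterministic program (capacities `λ`, `μ`). -/
def IsOptimal (x : Fin I → Fin J → Fin T → Fin T → ℝ) : Prop :=
  AssignmentFeasible K.lam K.mu x ∧
    ∀ y, AssignmentFeasible K.lam K.mu y → K.objective y ≤ K.objective x

/-- The maximum offline reward for realized arrivals `a` (demand) and `b` (supply): the value of
the offline matching program. (The feasible set is compact and contains `0`.) -/
def offValue (a : Fin I → Fin T → ℝ) (b : Fin J → Fin T → ℝ) : ℝ :=
  sSup {c | ∃ x, AssignmentFeasible a b x ∧ c = K.objective x}

/-- `∑_{j'} ∑_{s' ≤ t} m_{j's'} x_{ij'ts'} / μ_{j's'}` for a supply path `m`. -/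
def routingMass (x : Fin I → Fin J → Fin T → Fin T → ℝ) (m : Fin J → Fin T → ℝ)
    (i : Fin I) (t : Fin T) : ℝ :=
  ∑ j', ∑ s' ∈ Finset.Iic t, m j' s' * (x i j' t s' / K.mu j' s')

/-- The probability `p_{ijts}(S_t)`. It is written as a function of the whole supply path `m`, but
when `x i j t s = 0` for `s > t`, it depends only on the arrivals up to period `t`. -/
def prob (x : Fin I → Fin J → Fin T → Fin T → ℝ) (m : Fin J → Fin T → ℝ)
    (i : Fin I) (j : Fin J) (t s : Fin T) : ℝ :=
  min (K.lam i t) (K.routingMass x m i t) / K.routingMass x m i t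
    * (m j s * (x i j t s / K.mu j s))

variable {Ω : Type*}

/-- Demand arrival indicator `Λ_{it}`, generated by the seed `u_t`. -/
def demandArr (u : Fin T → Ω → ℝ) (ω : Ω) (i : Fin I) (t : Fin T) : ℝ :=
  drawIndicator (fun k => K.lam k t) i (u t ω)

/-- Supply arrival indicator `M_{js}`, generated by the seed `v_s`. -/
def supplyArr (v : Fin T → Ω → ℝ) (ω : Ω) (j : Fin J) (s : Fin T) : ℝ :=
  drawIndicator (fun k => K.mu k s) j (v s ω)

/-- The maximum offline reward `V^OFF(Λ, M)`. -/
def rewardOff (u v : Fin T → Ω → ℝ) (ω : Ω) : ℝ :=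
  K.offValue (K.demandArr u ω) (K.supplyArr v ω)

/-- The σ-algebra generated by `S_t`, the supply arrivals in the periods `1, …, t`. -/
abbrev infoUpTo (v : Fin T → Ω → ℝ) (t : Fin T) : MeasurableSpace Ω :=
  MeasurableSpace.comap (fun ω (j : Fin J) (s : Finset.Iic t) => K.supplyArr v ω j s) inferInstance

/-- The threshold `h_{js}(S_t)` of the simulation-based threshold policy, with bound `1` on the
expected number of demand units sent to `(j,s)`. -/
def threshold [MeasurableSpace Ω] (P : Measure Ω) (x : Fin I → Fin J → Fin T → Fin T → ℝ)
    (v : Fin T → Ω → ℝ) (j : Fin J) (s t : Fin T) : Ω → ℝ :=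
  P[fun ω =>
      (∑ t' ∈ Finset.Ioi t, ∑ i, K.r i j t' s * K.prob x (K.supplyArr v ω) i j t' s) /
        (1 + 1 - ∑ t' ∈ Finset.Iic t, ∑ i, K.prob x (K.supplyArr v ω) i j t' s)
    | K.infoUpTo v t]

/-- `X_{ijts} = 1`: demand unit `(i,t)` arrives and the separation step, using the seed `w_t`, picks
the supply unit `(j,s)`, which has probability `p_{ijts}(S_t) / λ_{it}`. -/
def Picked (x : Fin I → Fin J → Fin T → Fin T → ℝ) (u v w : Fin T → Ω → ℝ) (ω : Ω)
    (i : Fin I) (j : Fin J) (t s : Fin T) : Prop :=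
  K.demandArr u ω i t = 1 ∧
    drawIndicator
      (fun c : Fin J ×ₗ Fin T =>
        K.prob x (K.supplyArr v ω) i (ofLex c).1 t (ofLex c).2 / K.lam i t)
      (toLex (j, s)) (w t ω) = 1

/-- Supply unit `(j,s)` has not been matched in any of the first `n` periods. -/
def Available [MeasurableSpace Ω] (P : Measure Ω) (x : Fin I → Fin J → Fin T → Fin T → ℝ)
    (u v w : Fin T → Ω → ℝ) (ω : Ω) (j : Fin J) (s : Fin T) : ℕ → Prop
  | 0 => True
  | n + 1 => Available P x u v w ω j s n ∧
      ∀ (hn : n < T) (i : Fin I),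
        ¬ (K.Picked x u v w ω i j ⟨n, hn⟩ s ∧ Available P x u v w ω j s n ∧
            K.threshold P x v j s ⟨n, hn⟩ ω ≤ K.r i j ⟨n, hn⟩ s)

/-- The algorithm matches demand unit `(i,t)` to supply unit `(j,s)`: the separation step sends
`(i,t)` to `(j,s)`, `(j,s)` is still available, and the reward reaches the threshold. -/
def Matched [MeasurableSpace Ω] (P : Measure Ω) (x : Fin I → Fin J → Fin T → Fin T → ℝ)
    (u v w : Fin T → Ω → ℝ) (ω : Ω) (i : Fin I) (j : Fin J) (t s : Fin T) : Prop :=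
  K.Picked x u v w ω i j t s ∧ K.Available P x u v w ω j s t ∧
    K.threshold P x v j s t ω ≤ K.r i j t s

open Classical in
/-- The total reward `V^ON` of the online matching algorithm run with the LP solution `x`. -/
def rewardOn [MeasurableSpace Ω] (P : Measure Ω) (x : Fin I → Fin J → Fin T → Fin T → ℝ)
    (u v w : Fin T → Ω → ℝ) (ω : Ω) : ℝ :=
  ∑ i, ∑ j, ∑ t, ∑ s, if K.Matched P x u v w ω i j t s then K.r i j t s else 0

end Market

end

/-!
The expectation of a feasible assignment for the realized arrivals is feasible for `LP(λ, μ)`,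
because demand and supply arrivals are independent; so the value of `x` bounds the expected offline
reward. The online algorithm loses a factor `1/2` twice.

Routing: with `c = x i j t s / μ j s`, the constraints of the program give
`E[M j s * Q i t] ≤ 2 * λ i t * μ j s`, and `min (λ, Q) / Q ≥ 1 - Q / (4 * λ)` turns this into
`E[p i j t s] ≥ c * (μ j s - μ j s / 2) = x i j t s / 2`.

Thresholds: fix a supply unit. Let `ρ t` and `π t ≥ 0` be the reward and the number of demand units
routed to it in period `t`, with `∑ π ≤ 1`, and let `G n` be `∑_{t ≥ n} ρ t` divided by
`2 - ∑_{t < n} π t`. Then `G 0` is half of the routed reward, `G T = 0`, and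
`G t = θ * ρ t + (1 - θ * π t) * G (t + 1)` for some `θ ∈ [0, 1]`. The threshold `h` is the
conditional expectation of `G (t + 1)`, and remains so given all decisions made so far, since the
supply arrivals are independent of the seeds behind these decisions. Replacing `G (t + 1)` by `h`,
the mixture is at most `h + ∑ (r - h)⁺ p`: accepting exactly the rewards `r ≥ h` earns at least the
expected decrease of `G` while the unit is available. Summing over the periods telescopes.
-/

lemma sum_sum_sum_sum_rotate {ι κ τ σ M : Type*} [Fintype ι] [Fintype κ] [Fintype τ] [Fintype σ]
    [AddCommMonoid M] (F : ι → κ → τ → σ → M) :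
    ∑ i, ∑ j, ∑ t, ∑ s, F i j t s = ∑ j, ∑ s, ∑ t, ∑ i, F i j t s := by
  rw [Finset.sum_comm]
  refine Finset.sum_congr rfl fun j _ => ?_
  rw [Finset.sum_comm_cycle, Finset.sum_congr rfl fun s _ => Finset.sum_comm]

lemma one_sub_div_four_mul_le_min_div {a q : ℝ} (ha : 0 < a) (hq : 0 < q) :
    1 - q / (4 * a) ≤ min a q / q := by
  rw [le_div_iff₀ hq, le_min_iff]
  constructor
  · have hsq : (1 - q / (4 * a)) * q = a - (2 * a - q) ^ 2 / (4 * a) := by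
      field_simp
      ring
    rw [hsq]
    exact sub_le_self _ (by positivity)
  · exact mul_le_of_le_one_left hq.le (sub_le_self _ (by positivity))

lemma integral_sum_sum {Ω ι κ : Type*} [MeasurableSpace Ω] {P : Measure Ω} (s : Finset ι)
    (t : Finset κ) {F : ι → κ → Ω → ℝ} (hF : ∀ i j, Integrable (F i j) P) :
    ∫ ω, ∑ i ∈ s, ∑ j ∈ t, F i j ω ∂P = ∑ i ∈ s, ∑ j ∈ t, ∫ ω, F i j ω ∂P := by
  rw [integral_finsetSum _ fun i _ => integrable_finsetSum _ fun j _ => hF i j]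
  exact Finset.sum_congr rfl fun i _ => integral_finsetSum _ fun j _ => hF i j

section Draw

variable {α : Type*} [Fintype α] [LinearOrder α]

lemma drawIndicator_eq_zero_or_one (q : α → ℝ) (a : α) (u : ℝ) :
    drawIndicator q a u = 0 ∨ drawIndicator q a u = 1 :=
  Set.indicator_eq_zero_or_self _ _ _

lemma drawIndicator_mem_Icc (q : α → ℝ) (a : α) (u : ℝ) :
    drawIndicator q a u ∈ Set.Icc 0 1 := by
  rcases drawIndicator_eq_zero_or_one q a u with h | h <;> simp [h]

lemma sum_filter_le_eq_sum_filter_lt_add (q : α → ℝ) (a : α) :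
    ∑ b with b ≤ a, q b = (∑ b with b < a, q b) + q a := by
  have hins : (Finset.univ.filter (· ≤ a)) = insert a (Finset.univ.filter (· < a)) := by
    ext b
    simp [le_iff_eq_or_lt]
  rw [hins, Finset.sum_insert (by simp), add_comm]

lemma drawIndicator_mul_eq_zero {q : α → ℝ} (hq : ∀ a, 0 ≤ q a) {a b : α} (hab : a ≠ b) (u : ℝ) :
    drawIndicator q a u * drawIndicator q b u = 0 := by
  wlog hlt : a < b generalizing a b
  · rw [mul_comm]
    exact this hab.symm (hab.lt_or_gt.resolve_left hlt)
  have hsum : ∑ c with c ≤ a, q c ≤ ∑ c with c < b, q c :=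
    Finset.sum_le_sum_of_subset_of_nonneg
      (Finset.monotone_filter_right _ fun c _ hc => hc.trans_lt hlt) fun c _ _ => hq c
  by_cases hu : u ∈ Set.Ico (∑ c with c < a, q c) (∑ c with c ≤ a, q c)
  · have hub : u ∉ Set.Ico (∑ c with c < b, q c) (∑ c with c ≤ b, q c) := fun h =>
      (hu.2.trans_le hsum).not_ge h.1
    rw [mul_comm]
    simp only [drawIndicator, Set.indicator_of_notMem hub, zero_mul]
  · simp only [drawIndicator, Set.indicator_of_notMem hu, zero_mul]

lemma measurable_drawIndicator {Ω : Type*} {m : MeasurableSpace Ω} {q : Ω → α → ℝ} {X : Ω → ℝ}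
    (hq : ∀ a, Measurable fun ω => q ω a) (hX : Measurable X) (a : α) :
    Measurable fun ω => drawIndicator (q ω) a (X ω) := by
  simp only [drawIndicator, Set.indicator_apply, Set.mem_Ico, Pi.one_apply]
  exact .ite ((measurableSet_le (Finset.measurable_sum _ fun b _ => hq b) hX).inter
    (measurableSet_lt hX (Finset.measurable_sum _ fun b _ => hq b))) measurable_const
    measurable_const

end Draw

section CondExp

variable {Ω : Type*} {m m₂ m' m₀ : MeasurableSpace Ω} {P : Measure Ω}

lemma condExp_comp_prodMk_of_indepFun [IsFiniteMeasure P] {E F : Type*} [MeasurableSpace E]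
    [StandardBorelSpace E] [Nonempty E] {mF : MeasurableSpace F} {X : Ω → E} {Y : Ω → F}
    (hX : Measurable X) (hY : Measurable Y) (hind : IndepFun Y X P) {f : F × E → ℝ}
    (hf : Measurable f) (hint : Integrable (fun ω => f (Y ω, X ω)) P) :
    P[fun ω => f (Y ω, X ω) | MeasurableSpace.comap Y mF]
      =ᵐ[P] fun ω => ∫ e, f (Y ω, e) ∂P.map X := by
  have hconst : condDistrib X Y P =ᵐ[P.map Y] Kernel.const F (P.map X) :=
    condDistrib_ae_eq_of_measure_eq_compProd Y hX.aemeasurable <| by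
      rw [Measure.compProd_const,
        (indepFun_iff_map_prod_eq_prod_map_map hY.aemeasurable hX.aemeasurable).1 hind]
  filter_upwards [condExp_prod_ae_eq_integral_condDistrib hY hX.aemeasurable hf.stronglyMeasurable
    hint, ae_of_ae_map hY.aemeasurable hconst] with ω hcond hω
  rw [hcond, hω, Kernel.const_apply]

lemma condExp_indicator_Ico_of_uniform [IsFiniteMeasure P] {F : Type*} {mF : MeasurableSpace F}
    {X : Ω → ℝ} {Y : Ω → F} (hX : Measurable X) (hunif : P.map X = volume.restrict (Set.Icc 0 1))
    (hY : Measurable Y)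
    (hind : Indep (MeasurableSpace.comap Y mF) (MeasurableSpace.comap X inferInstance) P)
    {a b : F → ℝ} (ha : Measurable a) (hb : Measurable b) (ha0 : ∀ y, 0 ≤ a y)
    (hab : ∀ y, a y ≤ b y) (hb1 : ∀ y, b y ≤ 1) :
    P[fun ω => (Set.Ico (a (Y ω)) (b (Y ω))).indicator 1 (X ω) | MeasurableSpace.comap Y mF]
      =ᵐ[P] fun ω => b (Y ω) - a (Y ω) := by
  have hlen : ∀ y, ∫ x, (Set.Ico (a y) (b y)).indicator 1 x ∂P.map X = b y - a y := fun y => by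
    have hsub : Set.Ico (a y) (b y) ⊆ Set.Icc 0 1 := fun x hx =>
      ⟨(ha0 y).trans hx.1, hx.2.le.trans (hb1 y)⟩
    rw [hunif, integral_indicator_one measurableSet_Ico,
      measureReal_restrict_apply measurableSet_Ico, Set.inter_eq_left.2 hsub,
      Real.volume_real_Ico_of_le (hab y)]
  have hset : MeasurableSet {z : F × ℝ | a z.1 ≤ z.2 ∧ z.2 < b z.1} :=
    (measurableSet_le (ha.comp measurable_fst) measurable_snd).inter
      (measurableSet_lt measurable_snd (hb.comp measurable_fst))
  exact (condExp_comp_prodMk_of_indepFun hX hY ((IndepFun_iff_Indep Y X P).2 hind)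
    (f := Set.indicator _ 1) (measurable_one.indicator hset)
    ((integrable_const 1).indicator (hY.prodMk hX hset))).trans (.of_forall fun ω => hlen (Y ω))

lemma setIntegral_inter_of_indep (hm₂ : m₂ ≤ m₀) (hm : m ≤ m₀) (hind : Indep m m₂ P) {g : Ω → ℝ}
    (hg : Measurable[m] g) {s t : Set Ω} (hs : MeasurableSet[m] s) (ht : MeasurableSet[m₂] t) :
    ∫ ω in s ∩ t, g ω ∂P = P.real t * ∫ ω in s, g ω ∂P := by
  have hsg : Measurable[m] (s.indicator g) := hg.indicator hs
  rw [Set.inter_comm, ← setIntegral_indicator (hm s hs), ← integral_indicator (hm s hs)]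
  exact (indep_of_indep_of_le_right hind.symm hsg.comap_le).setIntegral_eq_mul hm₂
    (hsg.mono hm le_rfl).aemeasurable ht (f := id) aestronglyMeasurable_id

lemma setIntegral_eq_of_isPiSystem (hm : m ≤ m₀) {S : Set (Set Ω)}
    (hgen : m = MeasurableSpace.generateFrom S) (hpi : IsPiSystem S) (huniv : Set.univ ∈ S)
    {f g : Ω → ℝ} (hf : Integrable f P) (hg : Integrable g P)
    (hfg : ∀ s ∈ S, ∫ ω in s, f ω ∂P = ∫ ω in s, g ω ∂P) {s : Set Ω} (hs : MeasurableSet[m] s) :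
    ∫ ω in s, f ω ∂P = ∫ ω in s, g ω ∂P := by
  have htotal : ∫ ω, f ω ∂P = ∫ ω, g ω ∂P := by simpa using hfg _ huniv
  induction s, hs using MeasurableSpace.induction_on_inter hgen hpi with
  | empty => simp
  | basic s hs => exact hfg s hs
  | compl s hs ih =>
    have hf' := integral_add_compl (hm s hs) hf
    have hg' := integral_add_compl (hm s hs) hg
    linarith
  | iUnion s hdisj hs ih =>
    rw [integral_iUnion (fun n => hm _ (hs n)) hdisj hf.integrableOn,
      integral_iUnion (fun n => hm _ (hs n)) hdisj hg.integrableOn]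
    exact tsum_congr ih

lemma condExp_sup_of_indep [IsFiniteMeasure P] (hm : m ≤ m') (hm' : m' ≤ m₀) (hm₂ : m₂ ≤ m₀)
    (hind : Indep m' m₂ P) {g : Ω → ℝ} (hg : Measurable[m'] g) (hgi : Integrable g P) :
    P[g | m ⊔ m₂] =ᵐ[P] P[g | m] := by
  have hsup : m ⊔ m₂ ≤ m₀ := sup_le (hm.trans hm') hm₂
  have hgen : m ⊔ m₂ = MeasurableSpace.generateFrom
      (Set.image2 (· ∩ ·) {s | MeasurableSet[m] s} {t | MeasurableSet[m₂] t}) := by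
    refine le_antisymm (sup_le (fun s hs => ?_) fun t ht => ?_) (MeasurableSpace.generateFrom_le ?_)
    · exact .basic _ ⟨s, hs, Set.univ, .univ, Set.inter_univ s⟩
    · exact .basic _ ⟨Set.univ, .univ, t, ht, Set.univ_inter t⟩
    · rintro _ ⟨s, hs, t, ht, rfl⟩
      exact (le_sup_left (a := m) (b := m₂) s hs).inter (le_sup_right (a := m) (b := m₂) t ht)
  have hpi : IsPiSystem
      (Set.image2 (· ∩ ·) {s | MeasurableSet[m] s} {t | MeasurableSet[m₂] t}) := by
    rintro _ ⟨s, hs, t, ht, rfl⟩ _ ⟨s', hs', t', ht', rfl⟩ -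
    exact ⟨s ∩ s', hs.inter hs', t ∩ t', ht.inter ht', Set.inter_inter_inter_comm s s' t t'⟩
  refine (ae_eq_condExp_of_forall_setIntegral_eq hsup hgi
    (fun _ _ _ => integrable_condExp.integrableOn) (fun s hs _ => ?_)
    (stronglyMeasurable_condExp.mono (le_sup_left (b := m₂))).aestronglyMeasurable).symm
  refine setIntegral_eq_of_isPiSystem hsup hgen hpi ⟨_, .univ, _, .univ, Set.inter_univ _⟩
    integrable_condExp hgi ?_ hs
  rintro _ ⟨s, hs, t, ht, rfl⟩
  rw [setIntegral_inter_of_indep hm₂ hm' hind (stronglyMeasurable_condExp.measurable.mono hm le_rfl)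
      (hm s hs) ht, setIntegral_inter_of_indep hm₂ hm' hind hg (hm s hs) ht,
    setIntegral_condExp (hm.trans hm') hgi hs]

lemma condExp_mul_of_condExp_ae_eq {f g h : Ω → ℝ} (hf : Measurable[m] f)
    (hfg : Integrable (fun ω => f ω * g ω) P) (hg : Integrable g P) (hgh : P[g | m] =ᵐ[P] h) :
    P[fun ω => f ω * g ω | m] =ᵐ[P] fun ω => f ω * h ω := by
  filter_upwards [condExp_mul_of_stronglyMeasurable_left hf.stronglyMeasurable hfg hg, hgh]
    with ω hpull hω
  exact hpull.trans (congrArg _ hω)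

lemma integral_mul_of_condExp_ae_eq [IsFiniteMeasure P] (hm : m ≤ m₀) {f g h : Ω → ℝ}
    (hf : Measurable[m] f) (hfg : Integrable (fun ω => f ω * g ω) P) (hg : Integrable g P)
    (hgh : P[g | m] =ᵐ[P] h) :
    ∫ ω, f ω * h ω ∂P = ∫ ω, f ω * g ω ∂P := by
  rw [← integral_condExp hm (f := fun ω => f ω * g ω),
    integral_congr_ae (condExp_mul_of_condExp_ae_eq hf hfg hg hgh)]

lemma condExp_drawIndicator_of_indep [IsFiniteMeasure P] {α : Type*} [Fintype α] [LinearOrder α]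
    (hm : m ≤ m₀) {X : Ω → ℝ} (hX : Measurable X) (hunif : P.map X = volume.restrict (Set.Icc 0 1))
    (hind : Indep m (MeasurableSpace.comap X inferInstance) P) {q : Ω → α → ℝ}
    (hq : ∀ a, Measurable[m] fun ω => q ω a) (hq0 : ∀ ω a, 0 ≤ q ω a) (hq1 : ∀ ω, ∑ a, q ω a ≤ 1)
    (a : α) : P[fun ω => drawIndicator (q ω) a (X ω) | m] =ᵐ[P] fun ω => q ω a := by
  have hdraw := condExp_indicator_Ico_of_uniform (mF := m) (Y := id) hX hunif (measurable_id'' hm)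
    (by rwa [MeasurableSpace.comap_id])
    (Finset.measurable_sum (Finset.univ.filter (· < a)) fun b _ => hq b)
    (Finset.measurable_sum (Finset.univ.filter (· ≤ a)) fun b _ => hq b)
    (fun ω => Finset.sum_nonneg fun b _ => hq0 ω b)
    (fun ω => by
      rw [sum_filter_le_eq_sum_filter_lt_add]
      exact le_add_of_nonneg_right (hq0 ω a))
    (fun ω => (Finset.sum_le_univ_sum_of_nonneg (hq0 ω)).trans (hq1 ω))
  simp only [sum_filter_le_eq_sum_filter_lt_add, MeasurableSpace.comap_id, id, add_sub_cancel_left]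
    at hdraw
  simpa only [drawIndicator, sum_filter_le_eq_sum_filter_lt_add] using hdraw

end CondExp

/-- A real function that is measurable with respect to `m` and bounded everywhere. Products and
sums of such functions are again of this kind, hence integrable for every finite measure. -/
structure BoundedMeasurable {Ω : Type*} (m : MeasurableSpace Ω) (f : Ω → ℝ) : Prop where
  measurable : Measurable[m] f
  bounded : ∃ C, ∀ ω, |f ω| ≤ C

namespace BoundedMeasurable

variable {Ω ι : Type*} {m m' m₀ : MeasurableSpace Ω} {f g : Ω → ℝ}

lemma of_mem_Icc {a b : ℝ} (hf : Measurable[m] f) (hfab : ∀ ω, f ω ∈ Set.Icc a b) :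
    BoundedMeasurable m f :=
  ⟨hf, max |a| |b|, fun ω => abs_le_max_abs_abs (hfab ω).1 (hfab ω).2⟩

lemma const (c : ℝ) : BoundedMeasurable m fun _ => c :=
  ⟨measurable_const, |c|, fun _ => le_rfl⟩

lemma mono (hf : BoundedMeasurable m f) (hm : m ≤ m') : BoundedMeasurable m' f :=
  ⟨hf.measurable.mono hm le_rfl, hf.bounded⟩

lemma mul (hf : BoundedMeasurable m f) (hg : BoundedMeasurable m g) :
    BoundedMeasurable m fun ω => f ω * g ω := by
  obtain ⟨C, hC⟩ := hf.bounded
  obtain ⟨D, hD⟩ := hg.bounded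
  refine ⟨hf.measurable.mul hg.measurable, C * D, fun ω => ?_⟩
  rw [abs_mul]
  exact mul_le_mul (hC ω) (hD ω) (abs_nonneg _) ((abs_nonneg _).trans (hC ω))

lemma sub (hf : BoundedMeasurable m f) (hg : BoundedMeasurable m g) :
    BoundedMeasurable m fun ω => f ω - g ω := by
  obtain ⟨C, hC⟩ := hf.bounded
  obtain ⟨D, hD⟩ := hg.bounded
  exact ⟨hf.measurable.sub hg.measurable, C + D,
    fun ω => (abs_sub _ _).trans (add_le_add (hC ω) (hD ω))⟩

lemma sum {s : Finset ι} {F : ι → Ω → ℝ} (hF : ∀ i ∈ s, BoundedMeasurable m (F i)) :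
    BoundedMeasurable m fun ω => ∑ i ∈ s, F i ω := by
  choose! C hC using fun i hi => (hF i hi).bounded
  exact ⟨Finset.measurable_sum s fun i hi => (hF i hi).measurable, ∑ i ∈ s, C i,
    fun ω => (Finset.abs_sum_le_sum_abs _ _).trans (Finset.sum_le_sum fun i hi => hC i hi ω)⟩

open Classical in
lemma ite_const {p : Ω → Prop} (hp : MeasurableSet[m] {ω | p ω}) (c : ℝ) :
    BoundedMeasurable m fun ω => if p ω then c else 0 :=
  ⟨.ite hp measurable_const measurable_const, |c|, fun ω => by
    split_ifs
    exacts [le_rfl, abs_zero.trans_le (abs_nonneg c)]⟩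

lemma integrable_mul {P : Measure Ω} (hf : BoundedMeasurable m₀ f) (hg : Integrable g P) :
    Integrable (fun ω => f ω * g ω) P := by
  obtain ⟨C, hC⟩ := hf.bounded
  exact hg.bdd_mul hf.measurable.aestronglyMeasurable (ae_of_all _ hC)

lemma integrable {P : Measure Ω} [IsFiniteMeasure P] (hf : BoundedMeasurable m₀ f) :
    Integrable f P := by
  simpa only [mul_one] using hf.integrable_mul (integrable_const (1 : ℝ))

end BoundedMeasurable

section ThresholdStep

lemma mix_le_add_sum_mul_posPart {ι : Type*} [Fintype ι] {r p : ι → ℝ} {θ : ℝ}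
    (hθ : θ ∈ Set.Icc 0 1) (hp : ∀ i, 0 ≤ p i) (h : ℝ) :
    θ * ∑ i, r i * p i + (1 - θ * ∑ i, p i) * h ≤ h + ∑ i, (r i - h)⁺ * p i := by
  have hgain : θ * ∑ i, (r i - h) * p i ≤ ∑ i, (r i - h)⁺ * p i := by
    rw [Finset.mul_sum]
    refine Finset.sum_le_sum fun i _ => ?_
    calc θ * ((r i - h) * p i) ≤ θ * ((r i - h)⁺ * p i) := by
          gcongr
          exacts [hθ.1, hp i, le_posPart _]
      _ ≤ (r i - h)⁺ * p i :=
          mul_le_of_le_one_left (mul_nonneg (posPart_nonneg _) (hp i)) hθ.2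
  simp only [sub_mul, Finset.sum_sub_distrib, ← Finset.mul_sum] at hgain
  linarith

variable {Ω : Type*} {m m' m₀ : MeasurableSpace Ω} {P : Measure Ω} [IsFiniteMeasure P]
  {ι : Type*} [Fintype ι] {r : ι → ℝ} {p X : ι → Ω → ℝ} {A A' W θ g h : Ω → ℝ}

lemma integrable_posPart_const_sub (c : ℝ) (hh : Integrable h P) :
    Integrable (fun ω => (c - h ω)⁺) P :=
  ((integrable_const c).sub hh).pos_part

lemma integral_mul_mix_le (hm : m ≤ m₀) (hA : BoundedMeasurable m A)
    (hA0 : ∀ ω, 0 ≤ A ω) (hθ : BoundedMeasurable m θ) (hθ01 : ∀ ω, θ ω ∈ Set.Icc 0 1)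
    (hp : ∀ i, BoundedMeasurable m (p i)) (hp0 : ∀ ω i, 0 ≤ p i ω) (hg : Integrable g P)
    (hh : Integrable h P) (hgh : P[g | m] =ᵐ[P] h) :
    ∫ ω, A ω * (θ ω * ∑ i, r i * p i ω + (1 - θ ω * ∑ i, p i ω) * g ω) ∂P ≤
      ∫ ω, A ω * (h ω + ∑ i, (r i - h ω)⁺ * p i ω) ∂P := by
  have hearn : BoundedMeasurable m fun ω => A ω * (θ ω * ∑ i, r i * p i ω) :=
    hA.mul (hθ.mul (.sum fun i _ => (BoundedMeasurable.const (r i)).mul (hp i)))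
  have hkeep : BoundedMeasurable m fun ω => A ω * (1 - θ ω * ∑ i, p i ω) :=
    hA.mul ((BoundedMeasurable.const 1).sub (hθ.mul (.sum fun i _ => hp i)))
  have hearni := (hearn.mono hm).integrable (P := P)
  have hkeepi {f : Ω → ℝ} (hf : Integrable f P) := (hkeep.mono hm).integrable_mul hf
  have hpos : ∀ i, Integrable (fun ω => (r i - h ω)⁺ * p i ω) P := fun i => by
    simpa only [mul_comm] using
      ((hp i).mono hm).integrable_mul (integrable_posPart_const_sub (r i) hh)
  calc ∫ ω, A ω * (θ ω * ∑ i, r i * p i ω + (1 - θ ω * ∑ i, p i ω) * g ω) ∂P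
      = ∫ ω, A ω * (θ ω * ∑ i, r i * p i ω) ∂P +
          ∫ ω, A ω * (1 - θ ω * ∑ i, p i ω) * g ω ∂P := by
        rw [← integral_add hearni (hkeepi hg)]
        simp only [mul_add, mul_assoc]
    _ = ∫ ω, A ω * (θ ω * ∑ i, r i * p i ω) ∂P +
          ∫ ω, A ω * (1 - θ ω * ∑ i, p i ω) * h ω ∂P := by
        rw [integral_mul_of_condExp_ae_eq hm hkeep.measurable (hkeepi hg) hg hgh]
    _ ≤ ∫ ω, A ω * (h ω + ∑ i, (r i - h ω)⁺ * p i ω) ∂P := by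
        rw [← integral_add hearni (hkeepi hh)]
        refine integral_mono (hearni.add (hkeepi hh))
          ((hA.mono hm).integrable_mul (hh.add (integrable_finsetSum _ fun i _ => hpos i)))
          fun ω => ?_
        dsimp only
        rw [mul_assoc, ← mul_add]
        exact mul_le_mul_of_nonneg_left
          (mix_le_add_sum_mul_posPart (hθ01 ω) (hp0 ω) (h ω)) (hA0 ω)

lemma integral_mul_add_sum_posPart_eq (hm : m ≤ m₀) (hA : BoundedMeasurable m A)
    (hp : ∀ i, BoundedMeasurable m (p i)) (hX : ∀ i, BoundedMeasurable m₀ (X i))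
    (hXp : ∀ i, P[X i | m] =ᵐ[P] p i) (hh : Measurable[m] h) (hhi : Integrable h P) :
    ∫ ω, A ω * (h ω + ∑ i, (r i - h ω)⁺ * p i ω) ∂P =
      ∫ ω, A ω * (h ω + ∑ i, (r i - h ω)⁺ * X i ω) ∂P := by
  have hgaini {Y : Ω → ℝ} (hY : BoundedMeasurable m₀ Y) (i : ι) :
      Integrable (fun ω => A ω * (r i - h ω)⁺ * Y ω) P := by
    simpa only [mul_comm, mul_left_comm, mul_assoc] using
      ((hA.mono hm).mul hY).integrable_mul (integrable_posPart_const_sub (r i) hhi)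
  have hAh := (hA.mono hm).integrable_mul hhi
  have hsplit {Y : ι → Ω → ℝ} (hY : ∀ i, BoundedMeasurable m₀ (Y i)) :
      ∫ ω, A ω * (h ω + ∑ i, (r i - h ω)⁺ * Y i ω) ∂P =
        ∫ ω, A ω * h ω ∂P + ∑ i, ∫ ω, A ω * (r i - h ω)⁺ * Y i ω ∂P := by
    rw [← integral_finsetSum _ fun i _ => hgaini (hY i) i,
      ← integral_add hAh (integrable_finsetSum _ fun i _ => hgaini (hY i) i)]
    simp only [mul_add, Finset.mul_sum, mul_assoc]
  rw [hsplit fun i => (hp i).mono hm, hsplit hX]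
  congr 1
  refine Finset.sum_congr rfl fun i _ => integral_mul_of_condExp_ae_eq hm
    (hA.measurable.mul ((measurable_const.sub hh).max measurable_const)) (hgaini (hX i) i)
    (hX i).integrable (hXp i)

lemma integral_mul_add_sum_posPart_le (hm : m ≤ m₀) (hm' : m' ≤ m₀) (hA : BoundedMeasurable m A)
    (hp : ∀ i, BoundedMeasurable m (p i)) (hX : ∀ i, BoundedMeasurable m₀ (X i))
    (hXp : ∀ i, P[X i | m] =ᵐ[P] p i) (hh : Measurable[m] h) (hhi : Integrable h P)
    (hA' : BoundedMeasurable m' A') (hW : Integrable W P) (hg : Integrable g P)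
    (hgh : P[g | m'] =ᵐ[P] h)
    (hle : ∀ᵐ ω ∂P, A ω * (h ω + ∑ i, (r i - h ω)⁺ * X i ω) ≤ W ω + A' ω * h ω) :
    ∫ ω, A ω * (h ω + ∑ i, (r i - h ω)⁺ * p i ω) ∂P ≤ ∫ ω, W ω ∂P + ∫ ω, A' ω * g ω ∂P := by
  have hA'i {f : Ω → ℝ} (hf : Integrable f P) := (hA'.mono hm').integrable_mul hf
  have hpos : ∀ i, Integrable (fun ω => (r i - h ω)⁺ * X i ω) P := fun i => by
    simpa only [mul_comm] using (hX i).integrable_mul (integrable_posPart_const_sub (r i) hhi)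
  rw [integral_mul_add_sum_posPart_eq hm hA hp hX hXp hh hhi,
    ← integral_mul_of_condExp_ae_eq hm' hA'.measurable (hA'i hg) hg hgh,
    ← integral_add hW (hA'i hhi)]
  exact integral_mono_ae
    ((hA.mono hm).integrable_mul (hhi.add (integrable_finsetSum _ fun i _ => hpos i)))
    (hW.add (hA'i hhi)) hle

end ThresholdStep

section Seeds

/-- The random variables `f k` are independent and uniform on `[0, 1]`. -/
structure IsIIDUniform {Ω κ : Type*} {m₀ : MeasurableSpace Ω} (f : κ → Ω → ℝ)
    (P : Measure Ω) : Prop where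
  measurable : ∀ k, Measurable (f k)
  map_eq : ∀ k, P.map (f k) = volume.restrict (Set.Icc 0 1)
  iIndepFun : iIndepFun f P

/-- The σ-algebra generated by the random variables `f k` with index `k ∈ S`. -/
abbrev seedAlgebra {Ω κ : Type*} (f : κ → Ω → ℝ) (S : Set κ) : MeasurableSpace Ω :=
  ⨆ k ∈ S, MeasurableSpace.comap (f k) inferInstance

variable {Ω κ κ' : Type*}

lemma seedAlgebra_mono (f : κ → Ω → ℝ) : Monotone (seedAlgebra f) :=
  fun _ _ h => biSup_mono h

lemma measurable_seedAlgebra {f : κ → Ω → ℝ} {S : Set κ} {k : κ} (hk : k ∈ S) :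
    Measurable[seedAlgebra f S] (f k) :=
  Measurable.of_comap_le
    (le_iSup₂ (f := fun k (_ : k ∈ S) => MeasurableSpace.comap (f k) inferInstance) k hk)

namespace IsIIDUniform

variable {m m₀ : MeasurableSpace Ω} {P : Measure Ω} {f : κ → Ω → ℝ} (hf : IsIIDUniform f P)
include hf

lemma precomp {g : κ' → κ} (hg : g.Injective) : IsIIDUniform (fun k => f (g k)) P :=
  ⟨fun k => hf.measurable (g k), fun k => hf.map_eq (g k), hf.iIndepFun.precomp hg⟩

lemma seedAlgebra_le (S : Set κ) : seedAlgebra f S ≤ m₀ :=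
  iSup₂_le fun k _ => (hf.measurable k).comap_le

lemma indep_seedAlgebra {S S' : Set κ} (hS : Disjoint S S') :
    Indep (seedAlgebra f S) (seedAlgebra f S') P :=
  indep_iSup_of_disjoint (fun k => (hf.measurable k).comap_le) hf.iIndepFun hS

variable [IsFiniteMeasure P] {α β : Type*} [Fintype α] [LinearOrder α] [Fintype β] [LinearOrder β]
  {S : Set κ} {k l : κ}

lemma condExp_drawIndicator (hk : k ∉ S) (hm : m ≤ seedAlgebra f S) {q : Ω → α → ℝ}
    (hq : ∀ a, Measurable[m] fun ω => q ω a) (hq0 : ∀ ω a, 0 ≤ q ω a) (hq1 : ∀ ω, ∑ a, q ω a ≤ 1)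
    (a : α) : P[fun ω => drawIndicator (q ω) a (f k ω) | m] =ᵐ[P] fun ω => q ω a := by
  have hind := hf.indep_seedAlgebra (Set.disjoint_singleton_right.2 hk)
  rw [seedAlgebra, seedAlgebra, iSup_singleton] at hind
  exact condExp_drawIndicator_of_indep (hm.trans (hf.seedAlgebra_le S)) (hf.measurable k)
    (hf.map_eq k) (indep_of_indep_of_le_left hind hm) hq hq0 hq1 a

lemma condExp_drawIndicator_mul_drawIndicator (hk : k ∉ S) (hl : l ∉ S) (hkl : k ≠ l)
    (hm : m ≤ seedAlgebra f S) {q : Ω → α → ℝ} {q' : Ω → β → ℝ}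
    (hq : ∀ a, Measurable[m] fun ω => q ω a) (hq0 : ∀ ω a, 0 ≤ q ω a) (hq1 : ∀ ω, ∑ a, q ω a ≤ 1)
    (hq' : ∀ b, Measurable[m] fun ω => q' ω b) (hq'0 : ∀ ω b, 0 ≤ q' ω b)
    (hq'1 : ∀ ω, ∑ b, q' ω b ≤ 1) (a : α) (b : β) :
    P[fun ω => drawIndicator (q ω) a (f k ω) * drawIndicator (q' ω) b (f l ω) | m]
      =ᵐ[P] fun ω => q ω a * q' ω b := by
  have hm₀ : m ≤ m₀ := hm.trans (hf.seedAlgebra_le S)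
  let mk := seedAlgebra f (insert k S)
  have hmk : m ≤ mk := hm.trans (seedAlgebra_mono f (Set.subset_insert k S))
  have hmk₀ : mk ≤ m₀ := hf.seedAlgebra_le _
  have hdraw : BoundedMeasurable mk fun ω => drawIndicator (q ω) a (f k ω) :=
    .of_mem_Icc (measurable_drawIndicator (fun a => (hq a).mono hmk le_rfl)
      (measurable_seedAlgebra (Set.mem_insert k S)) a) fun ω => drawIndicator_mem_Icc _ _ _
  have hdraw' : Integrable (fun ω => drawIndicator (q' ω) b (f l ω)) P :=
    (BoundedMeasurable.of_mem_Icc (measurable_drawIndicator (fun b => (hq' b).mono hm₀ le_rfl)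
      (hf.measurable l) b) fun ω => drawIndicator_mem_Icc _ _ _).integrable
  have hinner : P[fun ω => drawIndicator (q ω) a (f k ω) * drawIndicator (q' ω) b (f l ω) | mk]
      =ᵐ[P] fun ω => q' ω b * drawIndicator (q ω) a (f k ω) := by
    simp only [mul_comm (q' _ b)]
    exact condExp_mul_of_condExp_ae_eq hdraw.measurable ((hdraw.mono hmk₀).integrable_mul hdraw')
      hdraw' (hf.condExp_drawIndicator (k := l) (S := insert k S) (by simp [hkl.symm, hl]) le_rfl
        (fun b => (hq' b).mono hmk le_rfl) hq'0 hq'1 b)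
  have hq'b : BoundedMeasurable m fun ω => q' ω b :=
    .of_mem_Icc (hq' b) fun ω =>
      ⟨hq'0 ω b, (Finset.single_le_sum (fun b _ => hq'0 ω b) (Finset.mem_univ b)).trans (hq'1 ω)⟩
  have houter := condExp_mul_of_condExp_ae_eq hq'b.measurable
    ((hq'b.mono hm₀).mul (hdraw.mono hmk₀)).integrable (hdraw.mono hmk₀).integrable
    (hf.condExp_drawIndicator hk hm hq hq0 hq1 a)
  simp only [mul_comm (q _ a)]
  exact ((condExp_condExp_of_le hmk hmk₀).symm.trans (condExp_congr_ae hinner)).trans houter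

omit [IsFiniteMeasure P] in
lemma integral_drawIndicator [IsProbabilityMeasure P] (k : κ) {q : α → ℝ} (hq0 : ∀ a, 0 ≤ q a)
    (hq1 : ∑ a, q a ≤ 1) (a : α) : ∫ ω, drawIndicator q a (f k ω) ∂P = q a := by
  have hcond := hf.condExp_drawIndicator (Set.notMem_empty k) le_rfl (q := fun _ => q)
    (fun _ => measurable_const) (fun _ => hq0) (fun _ => hq1) a
  rw [← integral_condExp (hf.seedAlgebra_le ∅), integral_congr_ae hcond]
  simp only [integral_const, probReal_univ, one_smul]

omit [IsFiniteMeasure P] in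
lemma integral_drawIndicator_mul_drawIndicator [IsProbabilityMeasure P] (hkl : k ≠ l) {q : α → ℝ}
    (hq0 : ∀ a, 0 ≤ q a) (hq1 : ∑ a, q a ≤ 1) {q' : β → ℝ} (hq'0 : ∀ b, 0 ≤ q' b)
    (hq'1 : ∑ b, q' b ≤ 1) (a : α) (b : β) :
    ∫ ω, drawIndicator q a (f k ω) * drawIndicator q' b (f l ω) ∂P = q a * q' b := by
  have hcond := hf.condExp_drawIndicator_mul_drawIndicator (Set.notMem_empty k)
    (Set.notMem_empty l) hkl le_rfl (q := fun _ => q) (q' := fun _ => q')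
    (fun _ => measurable_const) (fun _ => hq0) (fun _ => hq1)
    (fun _ => measurable_const) (fun _ => hq'0) (fun _ => hq'1) a b
  rw [← integral_condExp (hf.seedAlgebra_le ∅), integral_congr_ae hcond]
  simp only [integral_const, probReal_univ, one_smul]

end IsIIDUniform

end Seeds

section RemainingValue

/-- The value ascribed to a supply unit before period `n` when demand worth `ρ t` is routed to it
with intensity `π t` in period `t`: the reward of the demand still to come, divided by the routing
budget `2 - ∑ t < n, π t`. -/
noncomputable def remainingValue {T : ℕ} (ρ π : Fin T → ℝ) (n : ℕ) : ℝ :=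
  (∑ t with n ≤ t.val, ρ t) / (1 + 1 - ∑ t with t.val < n, π t)

variable {T : ℕ} {ρ π : Fin T → ℝ}

lemma remainingValue_zero : remainingValue ρ π 0 = 1 / 2 * ∑ t, ρ t := by
  simp only [remainingValue, zero_le, Finset.filter_true, not_lt_zero, Finset.filter_false,
    Finset.sum_empty]
  ring

lemma remainingValue_last : remainingValue ρ π T = 0 := by
  simp only [remainingValue, not_le_of_gt (Fin.isLt _), Finset.filter_false, Finset.sum_empty,
    zero_div]

lemma one_le_two_sub_sum_filter (hπ0 : ∀ t, 0 ≤ π t) (hπ1 : ∑ t, π t ≤ 1) (n : ℕ) :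
    1 ≤ 1 + 1 - ∑ t with t.val < n, π t :=
  le_sub_iff_add_le.2 (add_le_add_right ((Finset.sum_le_univ_sum_of_nonneg hπ0).trans hπ1) 1)

lemma inv_two_sub_sum_filter_mem_Icc (hπ0 : ∀ t, 0 ≤ π t) (hπ1 : ∑ t, π t ≤ 1) (n : ℕ) :
    (1 + 1 - ∑ t with t.val < n, π t)⁻¹ ∈ Set.Icc (0 : ℝ) 1 :=
  have h := one_le_two_sub_sum_filter hπ0 hπ1 n
  ⟨inv_nonneg.2 (zero_le_one.trans h), inv_le_one_of_one_le₀ h⟩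

lemma remainingValue_nonneg (hρ0 : ∀ t, 0 ≤ ρ t) (hπ0 : ∀ t, 0 ≤ π t) (hπ1 : ∑ t, π t ≤ 1)
    (n : ℕ) : 0 ≤ remainingValue ρ π n :=
  div_nonneg (Finset.sum_nonneg fun t _ => hρ0 t)
    (zero_le_one.trans (one_le_two_sub_sum_filter hπ0 hπ1 n))

lemma remainingValue_eq_mix (hπ0 : ∀ t, 0 ≤ π t) (hπ1 : ∑ t, π t ≤ 1) (t : Fin T) :
    remainingValue ρ π t = (1 + 1 - ∑ s with s.val < t.val, π s)⁻¹ * ρ t +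
      (1 - (1 + 1 - ∑ s with s.val < t.val, π s)⁻¹ * π t) * remainingValue ρ π (t + 1) := by
  have hfuture : ∑ s with t.val ≤ s.val, ρ s = ρ t + ∑ s with t.val + 1 ≤ s.val, ρ s := by
    rw [← Finset.sum_insert (by simp)]
    congr 1
    ext s
    simp only [Finset.mem_filter_univ, Finset.mem_insert, Fin.ext_iff]
    omega
  have hpast : ∑ s with s.val < t.val + 1, π s = π t + ∑ s with s.val < t.val, π s := by
    rw [← Finset.sum_insert (by simp)]
    congr 1
    ext s
    simp only [Finset.mem_filter_univ, Finset.mem_insert, Fin.ext_iff]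
    omega
  have hnow := one_le_two_sub_sum_filter hπ0 hπ1 t
  have hnext := one_le_two_sub_sum_filter hπ0 hπ1 (t + 1)
  rw [remainingValue, remainingValue, hfuture]
  rw [hpast] at hnext ⊢
  generalize ∑ s with s.val < t.val, π s = p at *
  have h1 : 1 + 1 - p ≠ 0 := by linarith
  have h2 : 1 + 1 - (π t + p) ≠ 0 := by linarith
  field_simp
  ring

end RemainingValue

section RandomPrograms

variable {Ω : Type*} [MeasurableSpace Ω] {P : Measure Ω}

lemma integrable_comp_of_finite_range [IsFiniteMeasure P] {E F : Type*} [MeasurableSpace E]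
    [MeasurableSingletonClass E] [NormedAddCommGroup F] {X : Ω → E} (hX : Measurable X)
    (hfin : (Set.range X).Finite) (G : E → F) : Integrable (fun ω => G (X ω)) P :=
  SimpleFunc.integrable_of_isFiniteMeasure
    (SimpleFunc.map G ⟨X, fun e => hX (measurableSet_singleton e), hfin⟩)

variable {I J T : ℕ}

lemma AssignmentFeasible.zero {a : Fin I → Fin T → ℝ} {b : Fin J → Fin T → ℝ}
    (ha : ∀ i t, 0 ≤ a i t) (hb : ∀ j s, 0 ≤ b j s) : AssignmentFeasible a b 0 where
  supply j s := by simpa using hb j s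
  demand i t := by simpa using ha i t
  pair i j t s := mul_nonneg (ha i t) (hb j s)
  causal _ _ _ _ _ := rfl
  nonneg _ _ _ _ := le_rfl

lemma AssignmentFeasible.integral {A : Ω → Fin I → Fin T → ℝ} {B : Ω → Fin J → Fin T → ℝ}
    {Y : Ω → Fin I → Fin J → Fin T → Fin T → ℝ}
    (hY : ∀ ω, AssignmentFeasible (A ω) (B ω) (Y ω))
    (hYi : ∀ i j t s, Integrable (fun ω => Y ω i j t s) P)
    (hAi : ∀ i t, Integrable (fun ω => A ω i t) P) (hBi : ∀ j s, Integrable (fun ω => B ω j s) P)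
    (hABi : ∀ i j t s, Integrable (fun ω => A ω i t * B ω j s) P)
    (hAB : ∀ i j t s, ∫ ω, A ω i t * B ω j s ∂P = (∫ ω, A ω i t ∂P) * ∫ ω, B ω j s ∂P) :
    AssignmentFeasible (fun i t => ∫ ω, A ω i t ∂P) (fun j s => ∫ ω, B ω j s ∂P)
      fun i j t s => ∫ ω, Y ω i j t s ∂P where
  supply j s := by
    rw [← integral_sum_sum _ _ fun i t => hYi i j t s]
    exact integral_mono
      (integrable_finsetSum _ fun i _ => integrable_finsetSum _ fun t _ => hYi i j t s)
      (hBi j s) fun ω => (hY ω).supply j s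
  demand i t := by
    rw [← integral_sum_sum _ _ fun j s => hYi i j t s]
    exact integral_mono
      (integrable_finsetSum _ fun j _ => integrable_finsetSum _ fun s _ => hYi i j t s)
      (hAi i t) fun ω => (hY ω).demand i t
  pair i j t s := by
    rw [← hAB]
    exact integral_mono (hYi i j t s) (hABi i j t s) fun ω => (hY ω).pair i j t s
  causal i j t s hts := by
    simp only [fun ω => (hY ω).causal i j t s hts, integral_zero]
  nonneg i j t s := integral_nonneg fun ω => (hY ω).nonneg i j t s

end RandomPrograms

namespace Market

variable {I J T : ℕ} {K : Market I J T}

section Routing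

variable {x : Fin I → Fin J → Fin T → Fin T → ℝ} (hx : AssignmentFeasible K.lam K.mu x)
  {m : Fin J → Fin T → ℝ} (hm0 : ∀ j s, 0 ≤ m j s)

include hx in
lemma route_nonneg (i : Fin I) (j : Fin J) (t s : Fin T) : 0 ≤ x i j t s / K.mu j s :=
  div_nonneg (hx.nonneg i j t s) (K.mu_pos j s).le

include hx in
lemma sum_route_eq_routingMass (i : Fin I) (t : Fin T) :
    ∑ j, ∑ s, m j s * (x i j t s / K.mu j s) = K.routingMass x m i t := by
  refine Finset.sum_congr rfl fun j _ => (Finset.sum_subset (Finset.subset_univ _) ?_).symm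
  intro s _ hs
  rw [hx.causal i j t s (not_le.1 (mt Finset.mem_Iic.2 hs)), zero_div, mul_zero]

include hx hm0

lemma route_le_routingMass (i : Fin I) (j : Fin J) (t s : Fin T) :
    m j s * (x i j t s / K.mu j s) ≤ K.routingMass x m i t := by
  have hterm : ∀ j s, 0 ≤ m j s * (x i j t s / K.mu j s) := fun j s =>
    mul_nonneg (hm0 j s) (route_nonneg hx i j t s)
  rw [← sum_route_eq_routingMass hx]
  exact (Finset.single_le_sum (f := fun s => m j s * (x i j t s / K.mu j s))
    (fun s _ => hterm j s) (Finset.mem_univ s)).trans (Finset.single_le_sum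
      (f := fun j => ∑ s, m j s * (x i j t s / K.mu j s))
      (fun j _ => Finset.sum_nonneg fun s _ => hterm j s) (Finset.mem_univ j))

lemma routingMass_nonneg (i : Fin I) (t : Fin T) : 0 ≤ K.routingMass x m i t :=
  Finset.sum_nonneg fun j _ => Finset.sum_nonneg fun s _ =>
    mul_nonneg (hm0 j s) (route_nonneg hx i j t s)

lemma routingRatio_mem_Icc (i : Fin I) (t : Fin T) :
    min (K.lam i t) (K.routingMass x m i t) / K.routingMass x m i t ∈ Set.Icc 0 1 :=
  have hQ := routingMass_nonneg hx hm0 i t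
  ⟨div_nonneg (le_min (K.lam_pos i t).le hQ) hQ, div_le_one_of_le₀ (min_le_right _ _) hQ⟩

lemma prob_nonneg (i : Fin I) (j : Fin J) (t s : Fin T) : 0 ≤ K.prob x m i j t s :=
  mul_nonneg (routingRatio_mem_Icc hx hm0 i t).1 (mul_nonneg (hm0 j s) (route_nonneg hx i j t s))

lemma prob_le_route (i : Fin I) (j : Fin J) (t s : Fin T) :
    K.prob x m i j t s ≤ m j s * (x i j t s / K.mu j s) :=
  mul_le_of_le_one_left (mul_nonneg (hm0 j s) (route_nonneg hx i j t s))
    (routingRatio_mem_Icc hx hm0 i t).2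

lemma sum_prob_le_one (hm1 : ∀ j s, m j s ≤ 1) (j : Fin J) (s : Fin T) :
    ∑ t, ∑ i, K.prob x m i j t s ≤ 1 := by
  calc ∑ t, ∑ i, K.prob x m i j t s ≤ ∑ t, ∑ i, x i j t s / K.mu j s :=
        Finset.sum_le_sum fun t _ => Finset.sum_le_sum fun i _ =>
          (prob_le_route hx hm0 i j t s).trans
            (mul_le_of_le_one_left (route_nonneg hx i j t s) (hm1 j s))
    _ = (∑ i, ∑ t, x i j t s) / K.mu j s := by
        rw [Finset.sum_comm]
        simp only [Finset.sum_div]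
    _ ≤ 1 := div_le_one_of_le₀ (hx.supply j s) (K.mu_pos j s).le

omit hm0 in
lemma sum_prob_le_lam (i : Fin I) (t : Fin T) : ∑ j, ∑ s, K.prob x m i j t s ≤ K.lam i t := by
  simp only [prob, ← Finset.mul_sum]
  rw [sum_route_eq_routingMass hx]
  by_cases hQ : K.routingMass x m i t = 0
  · rw [hQ, mul_zero]
    exact (K.lam_pos i t).le
  · rw [div_mul_cancel₀ _ hQ]
    exact min_le_left _ _

omit hm0 in
lemma sum_prob_div_lam_le_one (i : Fin I) (t : Fin T) :
    ∑ c : Fin J ×ₗ Fin T, K.prob x m i (ofLex c).1 t (ofLex c).2 / K.lam i t ≤ 1 := by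
  have hlex : ∑ c : Fin J ×ₗ Fin T, K.prob x m i (ofLex c).1 t (ofLex c).2 =
      ∑ j, ∑ s, K.prob x m i j t s := by
    rw [← Fintype.sum_prod_type' (f := fun j s => K.prob x m i j t s)]
    exact Fintype.sum_equiv ofLex _ _ fun _ => rfl
  rw [← Finset.sum_div, hlex]
  exact div_le_one_of_le₀ (sum_prob_le_lam hx i t) (K.lam_pos i t).le

end Routing

section Arrivals

variable {Ω : Type*} {m : MeasurableSpace Ω} {u v w : Fin T → Ω → ℝ}

lemma supplyArr_mem_Icc (ω : Ω) (j : Fin J) (s : Fin T) : K.supplyArr v ω j s ∈ Set.Icc 0 1 :=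
  drawIndicator_mem_Icc _ _ _

lemma supplyArr_nonneg (ω : Ω) (j : Fin J) (s : Fin T) : 0 ≤ K.supplyArr v ω j s :=
  (supplyArr_mem_Icc ω j s).1

lemma boundedMeasurable_supplyArr {s : Fin T} (hv : Measurable[m] (v s)) (j : Fin J) :
    BoundedMeasurable m fun ω => K.supplyArr v ω j s :=
  .of_mem_Icc (measurable_drawIndicator (q := fun _ k => K.mu k s) (fun _ => measurable_const) hv j)
    fun ω => supplyArr_mem_Icc ω j s

lemma boundedMeasurable_demandArr {t : Fin T} (hu : Measurable[m] (u t)) (i : Fin I) :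
    BoundedMeasurable m fun ω => K.demandArr u ω i t :=
  .of_mem_Icc
    (measurable_drawIndicator (q := fun _ k => K.lam k t) (fun _ => measurable_const) hu i)
    fun _ => drawIndicator_mem_Icc _ _ _

lemma measurable_supplyArr_infoUpTo {s t : Fin T} (hst : s ≤ t) (j : Fin J) :
    Measurable[K.infoUpTo v t] fun ω => K.supplyArr v ω j s := by
  have heval : Measurable fun f : Fin J → Finset.Iic t → ℝ => f j ⟨s, Finset.mem_Iic.2 hst⟩ := by
    fun_prop
  exact heval.comp (comap_measurable _)

lemma infoUpTo_le {t : Fin T} (hM : ∀ j, ∀ s ≤ t, Measurable[m] fun ω => K.supplyArr v ω j s) :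
    K.infoUpTo v t ≤ m :=
  Measurable.comap_le <| measurable_pi_iff.2 fun j => measurable_pi_iff.2 fun s =>
    hM j s (Finset.mem_Iic.1 s.2)

lemma infoUpTo_mono : Monotone (K.infoUpTo v) := fun _ _ h =>
  infoUpTo_le fun j _ hs => measurable_supplyArr_infoUpTo (hs.trans h) j

lemma boundedMeasurable_prob {x : Fin I → Fin J → Fin T → Fin T → ℝ}
    (hx : AssignmentFeasible K.lam K.mu x) {t : Fin T}
    (hM : ∀ j, ∀ s ≤ t, Measurable[m] fun ω => K.supplyArr v ω j s) (i : Fin I) (j : Fin J)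
    (s : Fin T) : BoundedMeasurable m fun ω => K.prob x (K.supplyArr v ω) i j t s := by
  rcases lt_or_ge t s with hts | hts
  · simpa only [prob, hx.causal i j t s hts, zero_div, mul_zero] using .const 0
  · have hQ : Measurable[m] fun ω => K.routingMass x (K.supplyArr v ω) i t :=
      Finset.measurable_sum _ fun j' _ => Finset.measurable_sum _ fun s' hs' =>
        (hM j' s' (Finset.mem_Iic.1 hs')).mul_const _
    exact .mul (.of_mem_Icc ((measurable_const.min hQ).div hQ) fun ω =>
        routingRatio_mem_Icc hx (supplyArr_nonneg ω) i t)
      (.mul (.of_mem_Icc (hM j s hts) fun ω => supplyArr_mem_Icc ω j s) (.const _))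

end Arrivals

section Policy

/-- The indices of the supply seeds `v_s` in the family `(u, v, w)` of all seeds. -/
def supplySeeds (T : ℕ) : Set (Fin T ⊕ Fin T ⊕ Fin T) :=
  Set.range fun s => Sum.inr (Sum.inl s)

/-- The indices of the demand seeds `u_t` and selection seeds `w_t` of the first `n` periods in the
family `(u, v, w)` of all seeds. -/
def decisionSeeds (T n : ℕ) : Set (Fin T ⊕ Fin T ⊕ Fin T) :=
  {k | Sum.elim (fun t : Fin T => t.val < n)
    (Sum.elim (fun _ => False) fun t : Fin T => t.val < n) k}

/-- The information consisting of the supply arrivals up to period `t` and of the demand and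
selection seeds of the first `n` periods. -/
noncomputable abbrev history (K : Market I J T) {Ω : Type*} (u v w : Fin T → Ω → ℝ) (t : Fin T)
    (n : ℕ) : MeasurableSpace Ω :=
  K.infoUpTo v t ⊔ seedAlgebra (Sum.elim u (Sum.elim v w)) (decisionSeeds T n)

/-- The remaining value of the supply unit `(j, s)` before period `n` for a supply path `m`; the
threshold of period `t` is the conditional expectation of its value at `n = t + 1`. -/
noncomputable def unitValue (K : Market I J T) (x : Fin I → Fin J → Fin T → Fin T → ℝ)
    (m : Fin J → Fin T → ℝ) (j : Fin J) (s : Fin T) (n : ℕ) : ℝ :=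
  remainingValue (fun t => ∑ i, K.r i j t s * K.prob x m i j t s)
    (fun t => ∑ i, K.prob x m i j t s) n

variable {Ω : Type*} {m m₀ : MeasurableSpace Ω} {P : Measure Ω}
  {x : Fin I → Fin J → Fin T → Fin T → ℝ} {u v w : Fin T → Ω → ℝ}

open Classical in
/-- The reward earned in period `t` by matching the supply unit `(j, s)`. -/
noncomputable def unitReward (K : Market I J T) (P : Measure Ω)
    (x : Fin I → Fin J → Fin T → Fin T → ℝ) (u v w : Fin T → Ω → ℝ) (j : Fin J) (t s : Fin T)
    (ω : Ω) : ℝ :=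
  ∑ i, if K.Matched P x u v w ω i j t s then K.r i j t s else 0

lemma decisionSeeds_mono : Monotone (decisionSeeds T) := by
  rintro n n' h (t | t | t) ht
  exacts [lt_of_lt_of_le ht h, ht, lt_of_lt_of_le ht h]

lemma disjoint_supplySeeds_decisionSeeds (n : ℕ) :
    Disjoint (supplySeeds T) (decisionSeeds T n) := by
  rw [Set.disjoint_left]
  rintro _ ⟨s, rfl⟩ hs
  exact hs

lemma measurable_supplyArr_supplySeeds (j : Fin J) (s : Fin T) :
    Measurable[seedAlgebra (Sum.elim u (Sum.elim v w)) (supplySeeds T)]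
      fun ω => K.supplyArr v ω j s :=
  (boundedMeasurable_supplyArr (measurable_seedAlgebra (f := Sum.elim u (Sum.elim v w))
    (S := supplySeeds T) (k := .inr (.inl s)) ⟨s, rfl⟩) j).measurable

lemma infoUpTo_le_supplySeeds (t : Fin T) :
    K.infoUpTo v t ≤ seedAlgebra (Sum.elim u (Sum.elim v w)) (supplySeeds T) :=
  infoUpTo_le fun j s _ => measurable_supplyArr_supplySeeds j s

lemma history_mono {t t' : Fin T} {n n' : ℕ} (ht : t ≤ t') (hn : n ≤ n') :
    K.history u v w t n ≤ K.history u v w t' n' :=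
  sup_le_sup (infoUpTo_mono ht) (seedAlgebra_mono _ (decisionSeeds_mono hn))

lemma history_le_seedAlgebra (t : Fin T) (n : ℕ) :
    K.history u v w t n ≤
      seedAlgebra (Sum.elim u (Sum.elim v w)) (supplySeeds T ∪ decisionSeeds T n) :=
  sup_le ((infoUpTo_le_supplySeeds t).trans (seedAlgebra_mono _ Set.subset_union_left))
    (seedAlgebra_mono _ Set.subset_union_right)

lemma measurable_supplyArr_history {s t : Fin T} (hst : s ≤ t) (n : ℕ) (j : Fin J) :
    Measurable[K.history u v w t n] fun ω => K.supplyArr v ω j s :=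
  (measurable_supplyArr_infoUpTo hst j).mono le_sup_left le_rfl

lemma available_succ_iff (t : Fin T) {ω : Ω} {j : Fin J} {s : Fin T} :
    K.Available P x u v w ω j s (t + 1) ↔
      K.Available P x u v w ω j s t ∧ ∀ i, ¬ K.Matched P x u v w ω i j t s := by
  simp only [Available, Matched, t.isLt, forall_true_left, Fin.eta]

lemma measurable_threshold (j : Fin J) (s t : Fin T) :
    Measurable[K.infoUpTo v t] (K.threshold P x v j s t) :=
  stronglyMeasurable_condExp.measurable

lemma threshold_eq_condExp_unitValue (j : Fin J) (s t : Fin T) :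
    K.threshold P x v j s t =
      P[fun ω => K.unitValue x (K.supplyArr v ω) j s (t + 1) | K.infoUpTo v t] := by
  have hIoi : Finset.Ioi t = Finset.univ.filter fun t' : Fin T => t.val + 1 ≤ t'.val := by
    ext t'
    simp only [Finset.mem_Ioi, Finset.mem_filter_univ, Fin.lt_def, Nat.succ_le_iff]
  have hIic : Finset.Iic t = Finset.univ.filter fun t' : Fin T => t'.val < t.val + 1 := by
    ext t'
    simp only [Finset.mem_Iic, Finset.mem_filter_univ, Fin.le_def, Nat.lt_succ_iff]
  simp only [threshold, unitValue, remainingValue, hIoi, hIic]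

section Feasible

variable (hx : AssignmentFeasible K.lam K.mu x)
include hx

lemma sum_prob_supplyArr_nonneg (ω : Ω) (j : Fin J) (t s : Fin T) :
    0 ≤ ∑ i, K.prob x (K.supplyArr v ω) i j t s :=
  Finset.sum_nonneg fun i _ => prob_nonneg hx (supplyArr_nonneg ω) i j t s

lemma sum_prob_supplyArr_le_one (ω : Ω) (j : Fin J) (s : Fin T) :
    ∑ t, ∑ i, K.prob x (K.supplyArr v ω) i j t s ≤ 1 :=
  sum_prob_le_one hx (supplyArr_nonneg ω) (fun j s => (supplyArr_mem_Icc ω j s).2) j s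

lemma unitValue_supplyArr_nonneg (ω : Ω) (j : Fin J) (s : Fin T) (n : ℕ) :
    0 ≤ K.unitValue x (K.supplyArr v ω) j s n :=
  remainingValue_nonneg
    (fun t => Finset.sum_nonneg fun i _ =>
      mul_nonneg (K.r_nonneg i j t s) (prob_nonneg hx (supplyArr_nonneg ω) i j t s))
    (fun t => sum_prob_supplyArr_nonneg hx ω j t s) (sum_prob_supplyArr_le_one hx ω j s) n

lemma boundedMeasurable_inv_two_sub_sum_prob {n : ℕ}
    (hM : ∀ j, ∀ s : Fin T, s.val < n → Measurable[m] fun ω => K.supplyArr v ω j s)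
    (j : Fin J) (s : Fin T) : BoundedMeasurable m fun ω =>
      (1 + 1 - ∑ t with t.val < n, ∑ i, K.prob x (K.supplyArr v ω) i j t s)⁻¹ :=
  .of_mem_Icc (measurable_const.sub (Finset.measurable_sum _ fun t ht =>
      Finset.measurable_sum _ fun i _ => (boundedMeasurable_prob hx (fun j' s' hs' =>
        hM j' s' (lt_of_le_of_lt hs' ((Finset.mem_filter_univ t).1 ht))) i j s).measurable)).inv
    fun ω => inv_two_sub_sum_filter_mem_Icc (fun t => sum_prob_supplyArr_nonneg hx ω j t s)
      (sum_prob_supplyArr_le_one hx ω j s) n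

lemma boundedMeasurable_unitValue (hM : ∀ j s, Measurable[m] fun ω => K.supplyArr v ω j s)
    (j : Fin J) (s : Fin T) (n : ℕ) :
    BoundedMeasurable m fun ω => K.unitValue x (K.supplyArr v ω) j s n := by
  simp only [unitValue, remainingValue, div_eq_mul_inv]
  exact .mul (.sum fun t _ => .sum fun i _ => (BoundedMeasurable.const _).mul
      (boundedMeasurable_prob hx (fun j s _ => hM j s) i j s))
    (boundedMeasurable_inv_two_sub_sum_prob hx (fun j s _ => hM j s) j s)

lemma threshold_nonneg (j : Fin J) (s t : Fin T) : 0 ≤ᵐ[P] K.threshold P x v j s t := by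
  rw [threshold_eq_condExp_unitValue]
  exact condExp_nonneg (ae_of_all _ fun ω => unitValue_supplyArr_nonneg hx ω j s _)

lemma measurableSet_picked {t : Fin T}
    (hM : ∀ j, ∀ s ≤ t, Measurable[m] fun ω => K.supplyArr v ω j s) (hu : Measurable[m] (u t))
    (hw : Measurable[m] (w t)) (i : Fin I) (j : Fin J) (s : Fin T) :
    MeasurableSet[m] {ω | K.Picked x u v w ω i j t s} :=
  ((boundedMeasurable_demandArr hu i).measurable (measurableSet_singleton 1)).inter
    (measurable_drawIndicator
      (q := fun ω (c : Fin J ×ₗ Fin T) =>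
        K.prob x (K.supplyArr v ω) i (ofLex c).1 t (ofLex c).2 / K.lam i t)
      (fun _ => (boundedMeasurable_prob hx hM i _ _).measurable.div_const _) hw (toLex (j, s))
      (measurableSet_singleton 1))

lemma measurableSet_available (j : Fin J) (s t : Fin T) {n : ℕ} (hn : n ≤ t + 1) :
    MeasurableSet[K.history u v w t n] {ω | K.Available P x u v w ω j s n} := by
  induction n with
  | zero => simp only [Available, Set.ofPred_true, MeasurableSet.univ]
  | succ n ih =>
    have hnT : n < T := (Nat.le_of_succ_le_succ hn).trans_lt t.isLt
    have hnt : (⟨n, hnT⟩ : Fin T) ≤ t := Nat.le_of_succ_le_succ hn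
    have havail : MeasurableSet[K.history u v w t (n + 1)]
        {ω | K.Available P x u v w ω j s n} :=
      history_mono le_rfl n.le_succ _ (ih (n.le_succ.trans hn))
    have hthreshold : Measurable[K.history u v w t (n + 1)] (K.threshold P x v j s ⟨n, hnT⟩) :=
      (measurable_threshold j s _).mono ((infoUpTo_mono hnt).trans le_sup_left) le_rfl
    have hseed {k : Fin T ⊕ Fin T ⊕ Fin T} (hk : k ∈ decisionSeeds T (n + 1)) :
        Measurable[K.history u v w t (n + 1)] (Sum.elim u (Sum.elim v w) k) :=
      (measurable_seedAlgebra hk).mono le_sup_right le_rfl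
    have hmatched (i : Fin I) : MeasurableSet[K.history u v w t (n + 1)]
        {ω | K.Matched P x u v w ω i j ⟨n, hnT⟩ s} :=
      (measurableSet_picked hx (fun j' s' hs' => measurable_supplyArr_history (hs'.trans hnt) _ j')
        (hseed (k := .inl ⟨n, hnT⟩) n.lt_succ_self)
        (hseed (k := .inr (.inr ⟨n, hnT⟩)) n.lt_succ_self) i j s).inter
        (havail.inter (measurableSet_le hthreshold measurable_const))
    simp only [available_succ_iff ⟨n, hnT⟩, Set.ofPred_and, Set.ofPred_forall]
    exact havail.inter (.iInter fun i => (hmatched i).compl)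

end Feasible

end Policy

section OnePeriod

variable {Ω : Type*} {m₀ : MeasurableSpace Ω} {P : Measure Ω}
  {x : Fin I → Fin J → Fin T → Fin T → ℝ} {u v w : Fin T → Ω → ℝ}

open Classical in
lemma ite_picked_eq (ω : Ω) (i : Fin I) (j : Fin J) (t s : Fin T) :
    (if K.Picked x u v w ω i j t s then (1 : ℝ) else 0) =
      drawIndicator (fun c : Fin J ×ₗ Fin T =>
        K.prob x (K.supplyArr v ω) i (ofLex c).1 t (ofLex c).2 / K.lam i t)
        (toLex (j, s)) (w t ω) * drawIndicator (fun k => K.lam k t) i (u t ω) := by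
  rw [Picked, demandArr]
  rcases drawIndicator_eq_zero_or_one (fun k => K.lam k t) i (u t ω) with hΛ | hΛ <;>
  rcases drawIndicator_eq_zero_or_one (fun c : Fin J ×ₗ Fin T =>
        K.prob x (K.supplyArr v ω) i (ofLex c).1 t (ofLex c).2 / K.lam i t)
        (toLex (j, s)) (w t ω) with hsel | hsel <;> simp [hΛ, hsel]

open Classical in
lemma unitReward_nonneg (ω : Ω) (j : Fin J) (t s : Fin T) :
    0 ≤ K.unitReward P x u v w j t s ω :=
  Finset.sum_nonneg fun i _ => ite_nonneg (K.r_nonneg i j t s) le_rfl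

open Classical in
lemma available_mul_threshold_add_gain_le {ω : Ω} {j : Fin J} {t s : Fin T}
    (hh : 0 ≤ K.threshold P x v j s t ω) :
    (if K.Available P x u v w ω j s t then 1 else 0) * (K.threshold P x v j s t ω +
        ∑ i, (K.r i j t s - K.threshold P x v j s t ω)⁺ *
          if K.Picked x u v w ω i j t s then 1 else 0) ≤
      K.unitReward P x u v w j t s ω +
        (if K.Available P x u v w ω j s (t + 1) then 1 else 0) * K.threshold P x v j s t ω := by
  by_cases hA : K.Available P x u v w ω j s t
  swap
  · rw [if_neg hA, zero_mul]
    exact add_nonneg (unitReward_nonneg ω j t s) (mul_nonneg (ite_nonneg zero_le_one le_rfl) hh)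
  generalize hh' : K.threshold P x v j s t ω = h at *
  have hgain (i : Fin I) :
      (K.r i j t s - h)⁺ * (if K.Picked x u v w ω i j t s then (1 : ℝ) else 0) =
        (if K.Matched P x u v w ω i j t s then K.r i j t s else 0) -
          if K.Matched P x u v w ω i j t s then h else 0 := by
    rcases le_or_gt h (K.r i j t s) with hr | hr
    · simp only [Matched, hA, hh', hr, posPart_of_nonneg (sub_nonneg.2 hr), and_true,
        mul_ite, mul_one, mul_zero]
      split_ifs <;> simp only [sub_zero]
    · simp [Matched, hh', hr.not_ge, posPart_of_nonpos (sub_nonpos.2 hr.le)]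
  have hkeep : h ≤ (∑ i, if K.Matched P x u v w ω i j t s then h else 0) +
      (if K.Available P x u v w ω j s (t + 1) then 1 else 0) * h := by
    by_cases hex : ∃ i, K.Matched P x u v w ω i j t s
    · obtain ⟨i, hi⟩ := hex
      refine le_add_of_le_of_nonneg ?_ (mul_nonneg (ite_nonneg zero_le_one le_rfl) hh)
      simpa only [if_pos hi] using Finset.single_le_sum (s := Finset.univ)
        (f := fun i => if K.Matched P x u v w ω i j t s then h else 0)
        (fun i _ => ite_nonneg hh le_rfl) (Finset.mem_univ i)
    · rw [if_pos ((available_succ_iff t).2 ⟨hA, not_exists.1 hex⟩), one_mul]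
      exact le_add_of_nonneg_left (Finset.sum_nonneg fun i _ => ite_nonneg hh le_rfl)
  simp only [if_pos hA, one_mul, hgain, Finset.sum_sub_distrib, unitReward]
  linarith

variable (hf : IsIIDUniform (Sum.elim u (Sum.elim v w)) P) (hx : AssignmentFeasible K.lam K.mu x)
include hf

lemma history_le (t : Fin T) (n : ℕ) : K.history u v w t n ≤ m₀ :=
  (history_le_seedAlgebra t n).trans (hf.seedAlgebra_le _)

lemma measurable_supplyArr (j : Fin J) (s : Fin T) :
    Measurable fun ω => K.supplyArr v ω j s :=
  (boundedMeasurable_supplyArr (hf.measurable (.inr (.inl s))) j).measurable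

include hx

open Classical in
lemma boundedMeasurable_ite_picked (i : Fin I) (j : Fin J) (t s : Fin T) :
    BoundedMeasurable m₀ fun ω => if K.Picked x u v w ω i j t s then (1 : ℝ) else 0 :=
  .ite_const (measurableSet_picked hx (fun j s _ => measurable_supplyArr hf j s)
    (hf.measurable (.inl t)) (hf.measurable (.inr (.inr t))) i j s) 1

lemma boundedMeasurable_unitReward (j : Fin J) (t s : Fin T) :
    BoundedMeasurable m₀ (K.unitReward P x u v w j t s) :=
  .sum fun i _ => .ite_const ((measurableSet_picked hx (fun j s _ => measurable_supplyArr hf j s)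
      (hf.measurable (.inl t)) (hf.measurable (.inr (.inr t))) i j s).inter
    ((history_le hf t t _ (measurableSet_available hx j s t t.val.le_succ)).inter
      (measurableSet_le ((measurable_threshold j s t).mono
        (le_sup_left.trans (history_le hf t 0)) le_rfl) measurable_const))) _

variable [IsFiniteMeasure P]

open Classical in
lemma condExp_picked (i : Fin I) (j : Fin J) (t s : Fin T) :
    P[fun ω => if K.Picked x u v w ω i j t s then (1 : ℝ) else 0 | K.history u v w t t]
      =ᵐ[P] fun ω => K.prob x (K.supplyArr v ω) i j t s := by
  have hdraw := hf.condExp_drawIndicator_mul_drawIndicator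
    (S := supplySeeds T ∪ decisionSeeds T t) (k := .inr (.inr t)) (l := .inl t)
    (by simp [supplySeeds, decisionSeeds]) (by simp [supplySeeds, decisionSeeds]) (by simp)
    (history_le_seedAlgebra t t)
    (q := fun ω (c : Fin J ×ₗ Fin T) =>
      K.prob x (K.supplyArr v ω) i (ofLex c).1 t (ofLex c).2 / K.lam i t)
    (q' := fun _ k => K.lam k t)
    (fun _ => (boundedMeasurable_prob hx
      (fun j _ hst => measurable_supplyArr_history hst _ j) i _ _).measurable.div_const _)
    (fun ω _ => div_nonneg (prob_nonneg hx (supplyArr_nonneg ω) _ _ _ _) (K.lam_pos i t).le)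
    (fun _ => sum_prob_div_lam_le_one hx i t)
    (fun _ => measurable_const) (fun _ k => (K.lam_pos k t).le) (fun _ => K.sum_lam_le_one t)
    (toLex (j, s)) i
  simpa only [ite_picked_eq, Sum.elim_inl, Sum.elim_inr, ofLex_toLex,
    div_mul_cancel₀ _ (K.lam_pos i t).ne'] using hdraw

lemma condExp_unitValue_history (j : Fin J) (s t : Fin T) (n : ℕ) :
    P[fun ω => K.unitValue x (K.supplyArr v ω) j s (t + 1) | K.history u v w t n]
      =ᵐ[P] K.threshold P x v j s t := by
  rw [threshold_eq_condExp_unitValue]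
  have hV := boundedMeasurable_unitValue hx (measurable_supplyArr_supplySeeds (K := K) (u := u)
    (v := v) (w := w)) j s (t + 1)
  exact condExp_sup_of_indep (infoUpTo_le_supplySeeds t) (hf.seedAlgebra_le _)
    (hf.seedAlgebra_le _) (hf.indep_seedAlgebra (disjoint_supplySeeds_decisionSeeds n))
    hV.measurable (hV.mono (hf.seedAlgebra_le _)).integrable

open Classical in
lemma integral_available_mul_unitValue_le (j : Fin J) (s t : Fin T) :
    ∫ ω, (if K.Available P x u v w ω j s t then 1 else 0) *
        K.unitValue x (K.supplyArr v ω) j s t ∂P ≤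
      ∫ ω, K.unitReward P x u v w j t s ω ∂P +
        ∫ ω, (if K.Available P x u v w ω j s (t + 1) then 1 else 0) *
          K.unitValue x (K.supplyArr v ω) j s (t + 1) ∂P := by
  have hA : BoundedMeasurable (K.history u v w t t)
      fun ω => if K.Available P x u v w ω j s t then (1 : ℝ) else 0 :=
    .ite_const (measurableSet_available hx j s t t.val.le_succ) 1
  have hA' : BoundedMeasurable (K.history u v w t (t + 1))
      fun ω => if K.Available P x u v w ω j s (t + 1) then (1 : ℝ) else 0 :=
    .ite_const (measurableSet_available hx j s t le_rfl) 1
  have hp (i : Fin I) : BoundedMeasurable (K.history u v w t t)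
      fun ω => K.prob x (K.supplyArr v ω) i j t s :=
    boundedMeasurable_prob hx (fun j _ hst => measurable_supplyArr_history hst _ j) i j s
  have hV : Integrable (fun ω => K.unitValue x (K.supplyArr v ω) j s (t + 1)) P :=
    (boundedMeasurable_unitValue hx (measurable_supplyArr hf) j s (t + 1)).integrable
  have hmix (ω : Ω) := remainingValue_eq_mix
    (ρ := fun t => ∑ i, K.r i j t s * K.prob x (K.supplyArr v ω) i j t s)
    (fun t => sum_prob_supplyArr_nonneg (v := v) hx ω j t s)
    (sum_prob_supplyArr_le_one hx ω j s) t
  calc ∫ ω, (if K.Available P x u v w ω j s t then 1 else 0) *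
        K.unitValue x (K.supplyArr v ω) j s t ∂P
      ≤ ∫ ω, (if K.Available P x u v w ω j s t then 1 else 0) * (K.threshold P x v j s t ω +
          ∑ i, (K.r i j t s - K.threshold P x v j s t ω)⁺ *
            K.prob x (K.supplyArr v ω) i j t s) ∂P := by
        simp only [unitValue, hmix]
        exact integral_mul_mix_le (history_le hf t t) hA (fun ω => ite_nonneg zero_le_one le_rfl)
          (boundedMeasurable_inv_two_sub_sum_prob hx (fun j s hst =>
            measurable_supplyArr_history (Fin.le_def.2 hst.le) _ j) j s)
          (fun ω => inv_two_sub_sum_filter_mem_Icc (fun t => sum_prob_supplyArr_nonneg hx ω j t s)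
            (sum_prob_supplyArr_le_one hx ω j s) t)
          hp (fun ω i => prob_nonneg hx (supplyArr_nonneg ω) i j t s) hV integrable_condExp
          (condExp_unitValue_history hf hx j s t t)
    _ ≤ _ := integral_mul_add_sum_posPart_le (history_le hf t t) (history_le hf t (t + 1)) hA hp
        (fun i => boundedMeasurable_ite_picked hf hx i j t s)
        (fun i => condExp_picked hf hx i j t s)
        ((measurable_threshold j s t).mono le_sup_left le_rfl) integrable_condExp hA'
        (boundedMeasurable_unitReward hf hx j t s).integrable hV
        (condExp_unitValue_history hf hx j s t (t + 1))
        ((threshold_nonneg hx j s t).mono fun _ => available_mul_threshold_add_gain_le)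

open Classical in
lemma half_integral_sum_prob_le_integral_unitReward (j : Fin J) (s : Fin T) :
    1 / 2 * ∫ ω, ∑ t, ∑ i, K.r i j t s * K.prob x (K.supplyArr v ω) i j t s ∂P ≤
      ∑ t, ∫ ω, K.unitReward P x u v w j t s ω ∂P := by
  let F (n : ℕ) : ℝ := ∫ ω, (if K.Available P x u v w ω j s n then 1 else 0) *
    K.unitValue x (K.supplyArr v ω) j s n ∂P
  have htelescope : ∑ t : Fin T, (F t - F (t + 1)) = F 0 - F T := by
    rw [Fin.sum_univ_eq_sum_range (fun n => F n - F (n + 1)), Finset.sum_range_sub']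
  have hfirst : F 0 =
      1 / 2 * ∫ ω, ∑ t, ∑ i, K.r i j t s * K.prob x (K.supplyArr v ω) i j t s ∂P := by
    simp [F, Available, unitValue, remainingValue_zero, integral_const_mul]
  have hlast : F T = 0 := by
    simp only [F, unitValue, remainingValue_last, mul_zero, integral_zero]
  rw [← hfirst, ← sub_zero (F 0), ← hlast, ← htelescope]
  exact Finset.sum_le_sum fun t _ =>
    sub_le_iff_le_add.2 (integral_available_mul_unitValue_le hf hx j s t)

end OnePeriod

section ExpectedRouting

variable {x : Fin I → Fin J → Fin T → Fin T → ℝ} (hx : AssignmentFeasible K.lam K.mu x)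
include hx

lemma route_mul_one_sub_le_prob {m : Fin J → Fin T → ℝ} (hm0 : ∀ j s, 0 ≤ m j s) (i : Fin I)
    (j : Fin J) (t s : Fin T) :
    m j s * (x i j t s / K.mu j s) * (1 - K.routingMass x m i t / (4 * K.lam i t)) ≤
      K.prob x m i j t s := by
  have hroute : 0 ≤ m j s * (x i j t s / K.mu j s) :=
    mul_nonneg (hm0 j s) (route_nonneg hx i j t s)
  rcases (routingMass_nonneg hx hm0 i t).eq_or_lt with hQ | hQ
  · have hzero : m j s * (x i j t s / K.mu j s) = 0 :=
      hroute.antisymm' ((route_le_routingMass hx hm0 i j t s).trans_eq hQ.symm)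
    rw [prob, hzero, zero_mul, mul_zero]
  · rw [prob, mul_comm]
    exact mul_le_mul_of_nonneg_right
      (one_sub_div_four_mul_le_min_div (K.lam_pos i t) hQ) hroute

variable {Ω : Type*} [MeasurableSpace Ω] {P : Measure Ω} [IsProbabilityMeasure P]
  {v : Fin T → Ω → ℝ} (hv : IsIIDUniform v P)
include hv

omit hx in
lemma integral_supplyArr (j : Fin J) (s : Fin T) : ∫ ω, K.supplyArr v ω j s ∂P = K.mu j s :=
  hv.integral_drawIndicator s (fun j => (K.mu_pos j s).le) (K.sum_mu_le_one s) j

omit hx in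
lemma integral_supplyArr_mul_supplyArr_le (j j' : Fin J) (s s' : Fin T) :
    ∫ ω, K.supplyArr v ω j s * K.supplyArr v ω j' s' ∂P ≤
      K.mu j s * K.mu j' s' + if j' = j then (if s' = s then K.mu j s else 0) else 0 := by
  have hμ : 0 ≤ K.mu j s * K.mu j' s' := mul_nonneg (K.mu_pos j s).le (K.mu_pos j' s').le
  rcases eq_or_ne s' s with rfl | hs
  · rcases eq_or_ne j' j with rfl | hj
    · rw [if_pos rfl, if_pos rfl]
      refine le_add_of_nonneg_of_le hμ ?_
      have hM := boundedMeasurable_supplyArr (K := K) (hv.measurable s') j'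
      rw [← integral_supplyArr hv]
      exact integral_mono (hM.mul hM).integrable hM.integrable fun ω =>
        mul_le_of_le_one_left (supplyArr_nonneg ω j' s') (supplyArr_mem_Icc ω j' s').2
    · rw [if_neg hj, add_zero]
      simpa only [supplyArr, drawIndicator_mul_eq_zero (fun j => (K.mu_pos j s').le) hj.symm,
        integral_zero] using hμ
  · rw [if_neg hs, ite_self, add_zero]
    exact (hv.integral_drawIndicator_mul_drawIndicator hs.symm (fun j => (K.mu_pos j s).le)
      (K.sum_mu_le_one s) (fun j => (K.mu_pos j s').le) (K.sum_mu_le_one s') j j').le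

lemma integral_supplyArr_mul_routingMass_le (i : Fin I) (j : Fin J) (t s : Fin T) :
    ∫ ω, K.supplyArr v ω j s * K.routingMass x (K.supplyArr v ω) i t ∂P ≤
      2 * (K.lam i t * K.mu j s) := by
  have hMM (j' : Fin J) (s' : Fin T) :
      Integrable (fun ω => K.supplyArr v ω j s * K.supplyArr v ω j' s') P :=
    ((boundedMeasurable_supplyArr (hv.measurable s) j).mul
      (boundedMeasurable_supplyArr (hv.measurable s') j')).integrable
  have hmoment (j' : Fin J) (s' : Fin T) :
      (∫ ω, K.supplyArr v ω j s * K.supplyArr v ω j' s' ∂P) * (x i j' t s' / K.mu j' s') ≤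
        K.mu j s * x i j' t s' + if j' = j then (if s' = s then x i j t s else 0) else 0 := by
    refine (mul_le_mul_of_nonneg_right (integral_supplyArr_mul_supplyArr_le hv j j' s s')
      (route_nonneg hx i j' t s')).trans_eq ?_
    rw [add_mul, mul_assoc, mul_div_cancel₀ _ (K.mu_pos j' s').ne']
    split_ifs with hj hs
    · rw [hj, hs, mul_div_cancel₀ _ (K.mu_pos j s).ne']
    all_goals rw [zero_mul]
  calc ∫ ω, K.supplyArr v ω j s * K.routingMass x (K.supplyArr v ω) i t ∂P
      = ∑ j', ∑ s', (∫ ω, K.supplyArr v ω j s * K.supplyArr v ω j' s' ∂P) *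
          (x i j' t s' / K.mu j' s') := by
        simp only [← sum_route_eq_routingMass hx, Finset.mul_sum, ← mul_assoc]
        rw [integral_sum_sum _ _ fun j' s' => (hMM j' s').mul_const _]
        simp only [integral_mul_const]
    _ ≤ ∑ j', ∑ s', (K.mu j s * x i j' t s' +
          if j' = j then (if s' = s then x i j t s else 0) else 0) :=
        Finset.sum_le_sum fun j' _ => Finset.sum_le_sum fun s' _ => hmoment j' s'
    _ = K.mu j s * (∑ j', ∑ s', x i j' t s') + x i j t s := by
        simp [Finset.sum_add_distrib, Finset.mul_sum, Finset.sum_ite_irrel]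
    _ ≤ K.mu j s * K.lam i t + K.lam i t * K.mu j s :=
        add_le_add (mul_le_mul_of_nonneg_left (hx.demand i t) (K.mu_pos j s).le) (hx.pair i j t s)
    _ = 2 * (K.lam i t * K.mu j s) := by ring

lemma half_le_integral_prob (i : Fin I) (j : Fin J) (t s : Fin T) :
    1 / 2 * x i j t s ≤ ∫ ω, K.prob x (K.supplyArr v ω) i j t s ∂P := by
  have hM (j : Fin J) (s : Fin T) := boundedMeasurable_supplyArr (K := K) (hv.measurable s) j
  have hMQ : Integrable
      (fun ω => K.supplyArr v ω j s * K.routingMass x (K.supplyArr v ω) i t) P :=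
    ((hM j s).mul (.sum fun j' _ => .sum fun s' _ => (hM j' s').mul (.const _))).integrable
  have hl := K.lam_pos i t
  have hmu := K.mu_pos j s
  have hroute := route_nonneg hx i j t s
  calc 1 / 2 * x i j t s
      = x i j t s / K.mu j s * (K.mu j s - 2 * (K.lam i t * K.mu j s) / (4 * K.lam i t)) := by
        field_simp
        ring
    _ ≤ x i j t s / K.mu j s * (K.mu j s -
          (∫ ω, K.supplyArr v ω j s * K.routingMass x (K.supplyArr v ω) i t ∂P) /
            (4 * K.lam i t)) := by
        gcongr
        exact integral_supplyArr_mul_routingMass_le hx hv i j t s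
    _ = ∫ ω, x i j t s / K.mu j s * (K.supplyArr v ω j s -
          K.supplyArr v ω j s * K.routingMass x (K.supplyArr v ω) i t / (4 * K.lam i t)) ∂P := by
        rw [integral_const_mul, integral_sub (hM j s).integrable (hMQ.div_const _), integral_div,
          integral_supplyArr hv]
    _ ≤ ∫ ω, K.prob x (K.supplyArr v ω) i j t s ∂P := by
        refine integral_mono (((hM j s).integrable.sub (hMQ.div_const _)).const_mul _)
          (boundedMeasurable_prob hx (fun j s _ => (hM j s).measurable) i j s).integrable
          fun ω => le_of_eq_of_le ?_ (route_mul_one_sub_le_prob hx (supplyArr_nonneg ω) i j t s)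
        ring

lemma half_sum_le_integral_sum_prob (j : Fin J) (s : Fin T) :
    1 / 2 * ∑ t, ∑ i, x i j t s * K.r i j t s ≤
      ∫ ω, ∑ t, ∑ i, K.r i j t s * K.prob x (K.supplyArr v ω) i j t s ∂P := by
  have hprob (t : Fin T) (i : Fin I) : Integrable (fun ω =>
      K.r i j t s * K.prob x (K.supplyArr v ω) i j t s) P :=
    (boundedMeasurable_prob hx (fun j s _ => (boundedMeasurable_supplyArr (hv.measurable s)
      j).measurable) i j s).integrable.const_mul _
  rw [integral_sum_sum _ _ hprob]
  simp only [integral_const_mul, Finset.mul_sum]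
  refine Finset.sum_le_sum fun t _ => Finset.sum_le_sum fun i _ => ?_
  calc 1 / 2 * (x i j t s * K.r i j t s) = K.r i j t s * (1 / 2 * x i j t s) := by ring
    _ ≤ _ := mul_le_mul_of_nonneg_left (half_le_integral_prob hx hv i j t s) (K.r_nonneg i j t s)

end ExpectedRouting

lemma exists_feasible_offValue_sub_le {a : Fin I → Fin T → ℝ} {b : Fin J → Fin T → ℝ}
    (ha : ∀ i t, 0 ≤ a i t) (hb : ∀ j s, 0 ≤ b j s) {ε : ℝ} (hε : 0 < ε) :
    ∃ y, AssignmentFeasible a b y ∧ K.offValue a b - ε ≤ K.objective y := by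
  have hne : {c | ∃ x, AssignmentFeasible a b x ∧ c = K.objective x}.Nonempty :=
    ⟨_, 0, .zero ha hb, rfl⟩
  obtain ⟨_, ⟨y, hy, rfl⟩, hlt⟩ := exists_lt_of_lt_csSup hne (sub_lt_self _ hε)
  exact ⟨y, hy, hlt.le⟩

section OfflineReward

variable {Ω : Type*} [MeasurableSpace Ω] {P : Measure Ω}

lemma integrable_objective {Y : Ω → Fin I → Fin J → Fin T → Fin T → ℝ}
    (hY : ∀ i j t s, Integrable (fun ω => Y ω i j t s) P) :
    Integrable (fun ω => K.objective (Y ω)) P :=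
  integrable_finsetSum _ fun i _ => integrable_finsetSum _ fun j _ =>
    integrable_finsetSum _ fun t _ => integrable_finsetSum _ fun s _ => (hY i j t s).mul_const _

lemma integral_objective {Y : Ω → Fin I → Fin J → Fin T → Fin T → ℝ}
    (hY : ∀ i j t s, Integrable (fun ω => Y ω i j t s) P) :
    ∫ ω, K.objective (Y ω) ∂P = K.objective fun i j t s => ∫ ω, Y ω i j t s ∂P := by
  have hYr i j t s : Integrable (fun ω => Y ω i j t s * K.r i j t s) P := (hY i j t s).mul_const _
  simp only [objective]
  rw [integral_sum_sum _ _ fun i j => integrable_finsetSum _ fun t _ => integrable_finsetSum _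
    fun s _ => hYr i j t s]
  simp only [integral_sum_sum _ _ (hYr _ _), integral_mul_const]

variable {u v w : Fin T → Ω → ℝ}

lemma integrable_comp_arrivals [IsFiniteMeasure P] {F : Type*} [NormedAddCommGroup F]
    (hu : ∀ t, Measurable (u t)) (hv : ∀ s, Measurable (v s))
    (G : (Fin I → Fin T → ℝ) × (Fin J → Fin T → ℝ) → F) :
    Integrable (fun ω => G (K.demandArr u ω, K.supplyArr v ω)) P := by
  have hmeas : Measurable fun ω => (K.demandArr u ω, K.supplyArr v ω) :=
    (measurable_pi_iff.2 fun i => measurable_pi_iff.2 fun t =>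
        (boundedMeasurable_demandArr (hu t) i).measurable).prodMk
      (measurable_pi_iff.2 fun j => measurable_pi_iff.2 fun s =>
        (boundedMeasurable_supplyArr (hv s) j).measurable)
  have hbinary (n : ℕ) : {a : Fin n → Fin T → ℝ | ∀ i t, a i t = 0 ∨ a i t = 1}.Finite :=
    Set.Finite.pi' fun _ => Set.Finite.pi' fun _ => Set.toFinite ({0, 1} : Set ℝ)
  refine integrable_comp_of_finite_range hmeas (((hbinary I).prod (hbinary J)).subset ?_) G
  rintro _ ⟨ω, rfl⟩
  exact ⟨fun _ _ => drawIndicator_eq_zero_or_one _ _ _,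
    fun _ _ => drawIndicator_eq_zero_or_one _ _ _⟩

lemma integrable_rewardOff [IsFiniteMeasure P] (hu : ∀ t, Measurable (u t))
    (hv : ∀ s, Measurable (v s)) : Integrable (K.rewardOff u v) P :=
  integrable_comp_arrivals hu hv fun z => K.offValue z.1 z.2

variable [IsProbabilityMeasure P] (huv : IsIIDUniform (Sum.elim u v) P)
include huv

lemma assignmentFeasible_integral {Y : Ω → Fin I → Fin J → Fin T → Fin T → ℝ}
    (hYi : ∀ i j t s, Integrable (fun ω => Y ω i j t s) P)
    (hY : ∀ ω, AssignmentFeasible (K.demandArr u ω) (K.supplyArr v ω) (Y ω)) :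
    AssignmentFeasible K.lam K.mu fun i j t s => ∫ ω, Y ω i j t s ∂P := by
  have hlam0 (t : Fin T) (i : Fin I) : 0 ≤ K.lam i t := (K.lam_pos i t).le
  have hmu0 (s : Fin T) (j : Fin J) : 0 ≤ K.mu j s := (K.mu_pos j s).le
  have hA (i : Fin I) (t : Fin T) : ∫ ω, K.demandArr u ω i t ∂P = K.lam i t :=
    huv.integral_drawIndicator (Sum.inl t) (hlam0 t) (K.sum_lam_le_one t) i
  have hB (j : Fin J) (s : Fin T) : ∫ ω, K.supplyArr v ω j s ∂P = K.mu j s :=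
    huv.integral_drawIndicator (Sum.inr s) (hmu0 s) (K.sum_mu_le_one s) j
  have hAm (i : Fin I) (t : Fin T) :=
    boundedMeasurable_demandArr (K := K) (huv.measurable (Sum.inl t)) i
  have hBm (j : Fin J) (s : Fin T) :=
    boundedMeasurable_supplyArr (K := K) (huv.measurable (Sum.inr s)) j
  simpa only [hA, hB] using AssignmentFeasible.integral hY hYi (fun i t => (hAm i t).integrable)
    (fun j s => (hBm j s).integrable) (fun i j t s => ((hAm i t).mul (hBm j s)).integrable)
    fun i j t s => by
      rw [hA, hB]
      exact huv.integral_drawIndicator_mul_drawIndicator Sum.inl_ne_inr (hlam0 t)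
        (K.sum_lam_le_one t) (hmu0 s) (K.sum_mu_le_one s) i j

lemma integral_rewardOff_le_objective {x : Fin I → Fin J → Fin T → Fin T → ℝ}
    (hx : K.IsOptimal x) : ∫ ω, K.rewardOff u v ω ∂P ≤ K.objective x := by
  have hu (t : Fin T) : Measurable (u t) := huv.measurable (Sum.inl t)
  have hv (s : Fin T) : Measurable (v s) := huv.measurable (Sum.inr s)
  refine le_of_forall_pos_le_add fun ε hε => ?_
  choose! y hy hyε using fun (z : (Fin I → Fin T → ℝ) × (Fin J → Fin T → ℝ))
    (hz : (∀ i t, 0 ≤ z.1 i t) ∧ ∀ j s, 0 ≤ z.2 j s) =>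
      exists_feasible_offValue_sub_le (K := K) hz.1 hz.2 hε
  let Y (ω : Ω) := y (K.demandArr u ω, K.supplyArr v ω)
  have hYi i j t s : Integrable (fun ω => Y ω i j t s) P :=
    integrable_comp_arrivals hu hv fun z => y z i j t s
  have harr (ω : Ω) : (∀ i t, 0 ≤ K.demandArr u ω i t) ∧ ∀ j s, 0 ≤ K.supplyArr v ω j s :=
    ⟨fun _ _ => (drawIndicator_mem_Icc _ _ _).1, supplyArr_nonneg ω⟩
  have hY (ω : Ω) : AssignmentFeasible (K.demandArr u ω) (K.supplyArr v ω) (Y ω) :=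
    hy (_, _) (harr ω)
  have hYε (ω : Ω) : K.rewardOff u v ω - ε ≤ K.objective (Y ω) := hyε (_, _) (harr ω)
  have hoff : Integrable (K.rewardOff u v) P := integrable_rewardOff hu hv
  calc ∫ ω, K.rewardOff u v ω ∂P
      = ∫ ω, (K.rewardOff u v ω - ε) ∂P + ε := by
        simp [integral_sub hoff (integrable_const ε)]
    _ ≤ ∫ ω, K.objective (Y ω) ∂P + ε :=
        add_le_add_left (integral_mono (hoff.sub (integrable_const ε)) (integrable_objective hYi)
          hYε) ε
    _ ≤ K.objective x + ε := by
        rw [integral_objective hYi]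
        exact add_le_add_left (hx.2 _ (assignmentFeasible_integral huv hYi hY)) ε

end OfflineReward

section OnlineReward

variable {Ω : Type*} {m₀ : MeasurableSpace Ω} {P : Measure Ω}
  {x : Fin I → Fin J → Fin T → Fin T → ℝ} {u v w : Fin T → Ω → ℝ}

lemma rewardOn_eq_sum_unitReward (ω : Ω) :
    K.rewardOn P x u v w ω = ∑ j, ∑ s, ∑ t, K.unitReward P x u v w j t s ω :=
  sum_sum_sum_sum_rotate _

variable (hf : IsIIDUniform (Sum.elim u (Sum.elim v w)) P)
  (hx : AssignmentFeasible K.lam K.mu x)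
include hf hx

lemma integrable_rewardOn [IsFiniteMeasure P] : Integrable (K.rewardOn P x u v w) P := by
  simp only [funext rewardOn_eq_sum_unitReward]
  exact (BoundedMeasurable.sum fun j _ => .sum fun s _ => .sum fun t _ =>
    boundedMeasurable_unitReward hf hx j t s).integrable

lemma quarter_objective_le_integral_rewardOn [IsProbabilityMeasure P] :
    1 / 4 * K.objective x ≤ ∫ ω, K.rewardOn P x u v w ω ∂P := by
  have hunit (j : Fin J) (s t : Fin T) : Integrable (K.unitReward P x u v w j t s) P :=
    (boundedMeasurable_unitReward hf hx j t s).integrable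
  have hv : IsIIDUniform v P := hf.precomp (Sum.inr_injective.comp Sum.inl_injective)
  calc 1 / 4 * K.objective x
      = ∑ j, ∑ s, 1 / 2 * (1 / 2 * ∑ t, ∑ i, x i j t s * K.r i j t s) := by
        rw [objective, sum_sum_sum_sum_rotate]
        simp only [← Finset.mul_sum, ← mul_assoc]
        norm_num
    _ ≤ ∑ j, ∑ s, 1 / 2 *
          ∫ ω, ∑ t, ∑ i, K.r i j t s * K.prob x (K.supplyArr v ω) i j t s ∂P := by
        gcongr with j _ s _
        exact half_sum_le_integral_sum_prob hx hv j s
    _ ≤ ∑ j, ∑ s, ∑ t, ∫ ω, K.unitReward P x u v w j t s ω ∂P :=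
        Finset.sum_le_sum fun j _ => Finset.sum_le_sum fun s _ =>
          half_integral_sum_prob_le_integral_unitReward hf hx j s
    _ = ∫ ω, K.rewardOn P x u v w ω ∂P := by
        simp only [rewardOn_eq_sum_unitReward]
        rw [integral_sum_sum _ _ fun j s => integrable_finsetSum _ fun t _ => hunit j s t]
        simp only [integral_finsetSum _ fun t _ => hunit _ _ t]

end OnlineReward

end Market

theorem mainTheorem5 {I J T : ℕ} (K : Market I J T)
    (x : Fin I → Fin J → Fin T → Fin T → ℝ) (hx : K.IsOptimal x)
    {Ω : Type*} [MeasurableSpace Ω] (P : Measure Ω) [IsProbabilityMeasure P]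
    (u v w : Fin T → Ω → ℝ)
    (hu : ∀ t, Measurable (u t)) (hv : ∀ t, Measurable (v t)) (hw : ∀ t, Measurable (w t))
    (hu_unif : ∀ t, P.map (u t) = volume.restrict (Set.Icc 0 1))
    (hv_unif : ∀ t, P.map (v t) = volume.restrict (Set.Icc 0 1))
    (hw_unif : ∀ t, P.map (w t) = volume.restrict (Set.Icc 0 1))
    (hindep : iIndepFun (Sum.elim u (Sum.elim v w)) P) :
    Integrable (K.rewardOn P x u v w) P ∧ Integrable (K.rewardOff u v) P ∧
      (∫ ω, K.rewardOn P x u v w ω ∂P) ≥ (1 / 4) * ∫ ω, K.rewardOff u v ω ∂P := by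
  have hf : IsIIDUniform (Sum.elim u (Sum.elim v w)) P :=
    ⟨Sum.forall.2 ⟨hu, Sum.forall.2 ⟨hv, hw⟩⟩,
      Sum.forall.2 ⟨hu_unif, Sum.forall.2 ⟨hv_unif, hw_unif⟩⟩, hindep⟩
  have huv : IsIIDUniform (Sum.elim u v) P := by
    convert hf.precomp (Sum.map_injective.2 ⟨Function.injective_id, Sum.inl_injective⟩) with k
    cases k <;> rfl
  refine ⟨Market.integrable_rewardOn hf hx.1, Market.integrable_rewardOff hu hv, ?_⟩
  calc 1 / 4 * ∫ ω, K.rewardOff u v ω ∂P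
      ≤ 1 / 4 * K.objective x := by
        gcongr
        exact Market.integral_rewardOff_le_objective huv hx
    _ ≤ ∫ ω, K.rewardOn P x u v w ω ∂P := Market.quarter_objective_le_integral_rewardOn hf hx.1
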